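/- Let $m\ge 2$ and let $O\subset\mathbb{R}^m$ be a compact strictly convex set (convex, with no line segment in its boundary) with nonempty interior and smooth (it is enough: $C^1$) boundary. Assume that $O$ is small, i.e. contained in a closed ball of radius smaller than $\sqrt2/4$. For $\mathbf{k}\in\mathbb{Z}^m$ let $O_{\mathbf{k}}=O+\mathbf{k}$. Consider the billiard on the torus $\mathbb{T}^m=\mathbb{R}^m/\mathbb{Z}^m$ with the obstacle $O$, that is, the flow of a point moving with unit speed along straight lines outside the obstacle, with the usual elastic reflections (angle of incidence equals angle of reflection) from its boundary. A trajectory tangent to the obstacle goes straight on, and a tangency is not a reflection. Trajectories are lifted to $\mathbb{R}^m\setminus\bigcup_{\mathbf{k}}\operatorname{int}O_{\mathbf{k}}$. The phase space is the product of $\mathbb{T}^m$ minus the interior of the obstacle with the unit sphere of velocities, where at boundary points of the obstacle the pre-collision and post-collision velocities are identified; it carries the quotient topology. The obstacle $O_{\mathbf{k}}$ is between $O_{\mathbf{i}}$ and $O_{\mathbf{j}}$ if $\mathbf{k}\ne\mathbf{i},\mathbf{j}$ and $O_{\mathbf{k}}$ intersects the convex hull of $O_{\mathbf{i}}\cup O_{\mathbf{j}}$.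 A finite or infinite sequence $(\mathbf{k}_n)$ in $\mathbb{Z}^m$ whose index set contains $0$ is admissible if $\mathbf{k}_0=\mathbf{0}$ and, for all indices $n$ for which the terms are defined, $\mathbf{k}_{n+1}\neq\mathbf{k}_n$, no obstacle is between $O_{\mathbf{k}_n}$ and $O_{\mathbf{k}_{n+1}}$, and $O_{\mathbf{k}_{n+1}}$ is not between $O_{\mathbf{k}_n}$ and $O_{\mathbf{k}_{n+2}}$. A lifted trajectory piece has type $(\mathbf{k}_0,\dots,\mathbf{k}_s)$ if it starts on the boundary of $O_{\mathbf{k}_0}$, then reflects consecutively from exactly $O_{\mathbf{k}_1},\dots,O_{\mathbf{k}_s}$, and ends at the last of these reflections. A full (two-sided) trajectory has admissible type if, for a suitable lifting and numbering of its reflections, it reflects consecutively from exactly the obstacles $O_{\mathbf{k}_n}$, $n\in\mathbb{Z}$, where $(\mathbf{k}_n)_{n\in\mathbb{Z}}$ is admissible. The admissible rotation set $AR\subset\mathbb{R}^m$ consists of all limits of sequences $(\mathbf{y}_n-\mathbf{x}_n)/t_n$ such that there is a lifted trajectory piece of admissible type from $\mathbf{x}_n$ to $\mathbf{y}_n$ of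 length $t_n$, and $t_n\to\infty$. A trajectory has rotation vector $\mathbf{u}$ if its lifting $T(t)$ satisfies $\lim_{t\to\infty}(T(t)-T(0))/t=\mathbf{u}$. Let $\mathbf{u}$ be in the interior of $AR$. Then there is a nonempty compact subset $Y$ of the phase space, invariant under the billiard flow, such that through every point of $Y$ passes a full trajectory, and every full trajectory that is in $Y$ at time $0$ has admissible type and rotation vector $\mathbf{u}$. In particular, there is a trajectory of admissible type with rotation vector $\mathbf{u}$. -/

import Mathlib

open Filter Topology

namespace TorusBilliard

/-- Euclidean space `ℝ^m`, the universal covering of the torus. -/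
abbrev E (m : ℕ) : Type := EuclideanSpace ℝ (Fin m)

/-- The integer vector `k ∈ ℤ^m`, viewed as a vector of `ℝ^m`. -/
def intVec {m : ℕ} (k : Fin m → ℤ) : E m := WithLp.toLp 2 (fun i => (k i : ℝ))

/-- The lattice `ℤ^m` in `ℝ^m`. -/
def intLattice (m : ℕ) : AddSubgroup (E m) where
  carrier := {x | ∃ k : Fin m → ℤ, x = intVec k}
  zero_mem' := ⟨0, by ext i; simp [intVec]⟩
  add_mem' := by
    rintro _ _ ⟨k, rfl⟩ ⟨l, rfl⟩
    exact ⟨k + l, by ext i; simp [intVec]⟩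
  neg_mem' := by
    rintro _ ⟨k, rfl⟩
    exact ⟨-k, by ext i; simp [intVec]⟩

/-- The torus `𝕋^m = ℝ^m / ℤ^m` with the quotient topology. -/
abbrev Torus (m : ℕ) : Type := E m ⧸ intLattice m

/-- The covering projection `ℝ^m → 𝕋^m`. -/
def proj {m : ℕ} (x : E m) : Torus m := QuotientAddGroup.mk x

/-! ### Obstacles -/

/-- The set `O` has a `C¹` boundary: near each of its boundary points it is the sublevel set
`{φ ≤ 0}` of a continuously differentiable function whose differential does not vanish there. -/
def HasSmoothBoundary {m : ℕ} (O : Set (E m)) : Prop :=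
  ∀ x ∈ frontier O, ∃ φ : E m → ℝ,
    ContDiffAt ℝ 1 φ x ∧ φ x = 0 ∧ fderiv ℝ φ x ≠ 0 ∧ ∀ᶠ y in 𝓝 x, (y ∈ O ↔ φ y ≤ 0)

/-- A (lifted) obstacle: a compact strictly convex set with nonempty interior and smooth
boundary.  For a compact convex set with nonempty interior, `StrictConvex` says exactly that the
boundary contains no nondegenerate line segment. -/
structure IsObstacle {m : ℕ} (O : Set (E m)) : Prop where
  isCompact : IsCompact O
  strictConvex : StrictConvex ℝ O
  nonempty_interior : (interior O).Nonempty
  smooth : HasSmoothBoundary O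

/-- The obstacle is small: it lies in a closed ball of radius smaller than `√2 / 4`. -/
def IsSmall {m : ℕ} (O : Set (E m)) : Prop :=
  ∃ (c : E m) (r : ℝ), r < Real.sqrt 2 / 4 ∧ O ⊆ Metric.closedBall c r

/-- The obstacle `O_k`, that is, `O` translated by `k ∈ ℤ^m`. -/
def obstacle {m : ℕ} (O : Set (E m)) (k : Fin m → ℤ) : Set (E m) := {x | x - intVec k ∈ O}

/-- `n` is an outer unit normal of the convex set `C` at the point `x`. -/
def IsOuterNormal {m : ℕ} (C : Set (E m)) (x n : E m) : Prop :=
  ‖n‖ = 1 ∧ ∀ y ∈ C, inner ℝ n (y - x) ≤ 0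

/-- Reflection of `v` in the hyperplane orthogonal to the unit vector `n`. -/
noncomputable def reflect {m : ℕ} (n v : E m) : E m := v - (2 * inner ℝ v n) • n

/-! ### The phase space -/

/-- Pairs (position, velocity): the product of the torus minus the interior of the obstacle with
the unit sphere of velocities. -/
abbrev PrePhase {m : ℕ} (O : Set (E m)) : Type :=
  {p : Torus m × E m // p.1 ∉ proj '' interior O ∧ ‖p.2‖ = 1}

/-- The gluing: at a boundary point of the obstacle, the pre-collision and the post-collision
velocities are identified. -/
def Glue {m : ℕ} (O : Set (E m)) (p q : PrePhase O) : Prop :=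
  ∃ x n : E m, x ∈ frontier O ∧ IsOuterNormal O x n ∧
    p.1.1 = proj x ∧ q.1.1 = proj x ∧ q.1.2 = reflect n p.1.2

/-- The phase space of the billiard flow, with the quotient topology. -/
abbrev PhaseSpace {m : ℕ} (O : Set (E m)) : Type := Quot (Glue O)

/-! ### Trajectories -/

/-- A full (two-sided) billiard trajectory, lifted to `ℝ^m`, parametrized by time (equivalently,
by arc length).  `pos t` is the position and `vel t` the velocity just after time `t`. The point
never enters the interior of an obstacle and moves along straight lines with unit speed, except
that on the boundary of an obstacle the incoming velocity `w` is reflected in the tangent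
hyperplane.  A tangential velocity is fixed by that reflection, so at a tangency the trajectory
goes straight on. -/
structure Trajectory {m : ℕ} (O : Set (E m)) where
  pos : ℝ → E m
  vel : ℝ → E m
  norm_vel : ∀ t, ‖vel t‖ = 1
  outside : ∀ t k, pos t ∉ interior (obstacle O k)
  motion : ∀ t, ∃ ε > 0, ∃ w : E m,
    (∀ s ∈ Set.Icc t (t + ε), pos s = pos t + (s - t) • vel t) ∧
    (∀ s ∈ Set.Icc (t - ε) t, pos s = pos t + (s - t) • w) ∧
    ((∀ k, pos t ∉ frontier (obstacle O k)) → vel t = w) ∧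
    (∀ k n, pos t ∈ frontier (obstacle O k) → IsOuterNormal (obstacle O k) (pos t) n →
      vel t = reflect n w)

theorem obstacle_eq_preimage {m : ℕ} (O : Set (E m)) (k : Fin m → ℤ) :
    obstacle O k = Homeomorph.subRight (intVec k) ⁻¹' O := rfl

theorem proj_notMem {m : ℕ} {O : Set (E m)} {x : E m}
    (h : ∀ k, x ∉ interior (obstacle O k)) : proj x ∉ proj '' interior O := by
  rintro ⟨y, hy, hyx⟩
  obtain ⟨k, hk⟩ : -y + x ∈ intLattice m := QuotientAddGroup.eq.1 hyx
  apply h k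
  rw [obstacle_eq_preimage, ← Homeomorph.preimage_interior]
  have : x - intVec k = y := by rw [← hk]; abel
  simpa [this] using hy

namespace Trajectory

variable {m : ℕ} {O : Set (E m)}

/-- The point of the phase space at which the trajectory is at time `t`. -/
def phase (T : Trajectory O) (t : ℝ) : PhaseSpace O :=
  Quot.mk _ ⟨(proj (T.pos t), T.vel t), proj_notMem (T.outside t), T.norm_vel t⟩

/-- At time `t` the trajectory reflects from `O_k`: it is on the boundary of `O_k` and leaves it
in a direction that is not tangent to it. -/
def ReflectsAt (T : Trajectory O) (t : ℝ) (k : Fin m → ℤ) : Prop :=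
  T.pos t ∈ frontier (obstacle O k) ∧
    ∃ n, IsOuterNormal (obstacle O k) (T.pos t) n ∧ 0 < inner ℝ (T.vel t) n

/-- The trajectory has rotation vector `u`. -/
def HasRotationVector (T : Trajectory O) (u : E m) : Prop :=
  Tendsto (fun t : ℝ => t⁻¹ • (T.pos t - T.pos 0)) atTop (𝓝 u)

/-- The full trajectory reflects consecutively, at an increasing sequence of times, from the
obstacles `O_{k n}`, `n ∈ ℤ`, and has no other reflections. -/
def HasType (T : Trajectory O) (k : ℤ → Fin m → ℤ) : Prop :=
  ∃ t : ℤ → ℝ, StrictMono t ∧ (∀ n, T.ReflectsAt (t n) (k n)) ∧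
    ∀ a j, T.ReflectsAt a j → ∃ n, a = t n

/-- The piece of the trajectory between the times `0` and `τ` has the type `(k 0, …, k s)`: it
starts on the boundary of `O_{k 0}`, then reflects consecutively from `O_{k 1}, …, O_{k s}`, the
last time at its end, and has no other reflections. -/
def PieceHasType (T : Trajectory O) (τ : ℝ) (s : ℕ) (k : ℕ → Fin m → ℤ) : Prop :=
  ∃ t : ℕ → ℝ, t 0 = 0 ∧ t s = τ ∧ (∀ i < s, t i < t (i + 1)) ∧
    T.pos 0 ∈ frontier (obstacle O (k 0)) ∧
    (∀ i, 1 ≤ i → i ≤ s → T.ReflectsAt (t i) (k i)) ∧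
    ∀ a ∈ Set.Ioo 0 τ, ∀ j, T.ReflectsAt a j → ∃ i ≤ s, a = t i

end Trajectory

/-! ### Admissible types -/

/-- The obstacle `O_k` is between `O_i` and `O_j`. -/
def Between {m : ℕ} (O : Set (E m)) (i j k : Fin m → ℤ) : Prop :=
  k ≠ i ∧ k ≠ j ∧ (obstacle O k ∩ convexHull ℝ (obstacle O i ∪ obstacle O j)).Nonempty

/-- Admissible two-sided sequences. -/
structure Admissible {m : ℕ} (O : Set (E m)) (k : ℤ → Fin m → ℤ) : Prop where
  zero : k 0 = 0
  ne : ∀ n, k (n + 1) ≠ k n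
  not_between : ∀ n j, ¬ Between O (k n) (k (n + 1)) j
  not_between_next : ∀ n, ¬ Between O (k n) (k (n + 2)) (k (n + 1))

/-- Admissible finite sequences `(k 0, …, k s)`. -/
structure FinAdmissible {m : ℕ} (O : Set (E m)) (s : ℕ) (k : ℕ → Fin m → ℤ) : Prop where
  zero : k 0 = 0
  ne : ∀ n, n + 1 ≤ s → k (n + 1) ≠ k n
  not_between : ∀ n, n + 1 ≤ s → ∀ j, ¬ Between O (k n) (k (n + 1)) j
  not_between_next : ∀ n, n + 2 ≤ s → ¬ Between O (k n) (k (n + 2)) (k (n + 1))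

/-- A full trajectory has admissible type: after a translation of the lifting by an integer
vector `j`, its type is an admissible sequence. -/
def Trajectory.HasAdmissibleType {m : ℕ} {O : Set (E m)} (T : Trajectory O) : Prop :=
  ∃ (j : Fin m → ℤ) (k : ℤ → Fin m → ℤ), Admissible O k ∧ T.HasType (fun n => j + k n)

/-- The admissible rotation set `AR`: all limits of displacement divided by length (time) along
sequences of trajectory pieces of admissible type whose lengths tend to infinity. -/
def admissibleRotationSet {m : ℕ} (O : Set (E m)) : Set (E m) :=
  {w | ∃ (T : ℕ → Trajectory O) (τ : ℕ → ℝ),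
    (∀ n, ∃ (s : ℕ) (k : ℕ → Fin m → ℤ), FinAdmissible O s k ∧ (T n).PieceHasType (τ n) s k) ∧
    Tendsto τ atTop atTop ∧
    Tendsto (fun n => (τ n)⁻¹ • ((T n).pos (τ n) - (T n).pos 0)) atTop (𝓝 w)}

/-- A subset of the phase space is invariant under the billiard flow (in both directions of
time): every trajectory that is in `Y` at time `0` is in `Y` at all times. -/
def IsInvariant {m : ℕ} (O : Set (E m)) (Y : Set (PhaseSpace O)) : Prop :=
  ∀ T : Trajectory O, T.phase 0 ∈ Y → ∀ t : ℝ, T.phase t ∈ Y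

end TorusBilliard

/-! Betweenness is invariant under lattice translations, so an admissible sequence is encoded by the
word of its steps `k (n+1) - k n`. Admissibility becomes a condition on single steps (`IsStep`) and
on neighbouring steps (`Follows`). Let `wordLen` be the infimum of the lengths of broken lines
visiting the obstacles of a word. It is additive under concatenation up to 1, and a trajectory piece
of that type has length within 2 of it: a broken line obeying the reflection law at convex obstacles
is almost shortest (`sum_le_pathLen_of_critical`). Hence the deviation `wordErr`, displacement minus
`wordLen` times `u`, is additive up to `‖u‖`, and trajectory pieces can be replaced by words.

Since `u` is interior to the rotation set, every direction is opposed by some word with large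
deviation, and finitely many words suffice by compactness of the sphere (`exists_finite_words`). Any
two words can be joined through two coordinate steps (`exists_connection`). Appending again and
again a word that points against the accumulated deviation gives arbitrarily long words all of whose
prefixes have bounded deviation (`exists_long_word`).

A shortest broken line for such a word obeys the reflection law, and admissibility turns it into a
billiard path: a segment meets no obstacle other than those at its ends, and a vertex is never on
the segment joining its neighbours, so every reflection is genuine. The conditions on the sequence
of obstacles, points and times are closed, and the bound `R` on admissible steps
(`exists_bound_isStep`) confines each term to a compact box. A compactness argument therefore yields
a two-sided itinerary with bounded deviation (`exists_isItinerary`), and its trajectory has rotation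
vector `u`.

The set `Y` consists of all phase points on trajectories of itineraries with one fixed deviation
bound. It is the continuous image of (itineraries) × [0,1], hence compact. It is invariant, and all
trajectories through it are good, because a phase point determines its trajectory up to a lattice
translation (`Trajectory.eq_shift_of_phase_eq`). -/

namespace TorusBilliard

variable {m : ℕ} {O : Set (E m)}

/-! ### The lattice -/

@[simp] theorem intVec_apply (k : Fin m → ℤ) (i : Fin m) : intVec k i = k i := rfl

@[simp] theorem intVec_zero : intVec (0 : Fin m → ℤ) = 0 := by ext i; simp

theorem intVec_add (k l : Fin m → ℤ) : intVec (k + l) = intVec k + intVec l := by ext i; simp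

theorem intVec_sub (k l : Fin m → ℤ) : intVec (k - l) = intVec k - intVec l := by ext i; simp

theorem inner_intVec (k l : Fin m → ℤ) :
    inner ℝ (intVec k) (intVec l) = ((∑ i, k i * l i : ℤ) : ℝ) := by
  simp [PiLp.inner_apply, mul_comm]

theorem one_le_norm_sq_intVec {k : Fin m → ℤ} (hk : k ≠ 0) : 1 ≤ ‖intVec k‖ ^ 2 := by
  rw [← real_inner_self_eq_norm_sq, inner_intVec]
  obtain ⟨i, hi⟩ := Function.ne_iff.1 hk
  have h1 : k i * k i ≤ ∑ i, k i * k i :=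
    Finset.single_le_sum (f := fun i => k i * k i) (fun j _ => mul_self_nonneg (k j))
      (Finset.mem_univ i)
  have h2 : 0 < k i * k i := mul_self_pos.2 hi
  exact_mod_cast (by omega : (1 : ℤ) ≤ ∑ i, k i * k i)

theorem one_le_norm_intVec {k : Fin m → ℤ} (hk : k ≠ 0) : 1 ≤ ‖intVec k‖ := by
  nlinarith [one_le_norm_sq_intVec hk, norm_nonneg (intVec k)]

theorem proj_eq_iff {x y : E m} : proj x = proj y ↔ ∃ k, x = y + intVec k := by
  rw [eq_comm]
  refine QuotientAddGroup.eq.trans ⟨?_, ?_⟩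
  · rintro ⟨k, hk⟩
    exact ⟨k, by rw [← hk]; abel⟩
  · rintro ⟨k, rfl⟩
    exact ⟨k, by abel⟩

theorem continuous_proj : Continuous (proj : E m → Torus m) := QuotientAddGroup.continuous_mk

theorem finite_norm_intVec_le (R : ℝ) : {k : Fin m → ℤ | ‖intVec k‖ ≤ R}.Finite := by
  refine (Set.finite_Icc (fun _ : Fin m => -⌈R⌉) (fun _ => ⌈R⌉)).subset fun k hk => ?_
  have h : ∀ i, |k i| ≤ ⌈R⌉ := fun i => by
    have h1 : ‖intVec k i‖ ≤ ‖intVec k‖ := PiLp.norm_apply_le _ i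
    have h2 : ((|k i| : ℤ) : ℝ) ≤ ⌈R⌉ := by
      rw [intVec_apply, Real.norm_eq_abs] at h1
      push_cast
      exact h1.trans (le_trans hk (Int.le_ceil R))
    exact_mod_cast h2
  exact ⟨fun i => (abs_le.1 (h i)).1, fun i => (abs_le.1 (h i)).2⟩

/-! ### Translates of the obstacle -/

theorem mem_obstacle {k : Fin m → ℤ} {x : E m} : x ∈ obstacle O k ↔ x - intVec k ∈ O := Iff.rfl

theorem add_mem_obstacle {k : Fin m → ℤ} {x : E m} (hx : x ∈ O) : x + intVec k ∈ obstacle O k := by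
  simpa [mem_obstacle] using hx

theorem mem_interior_obstacle {k : Fin m → ℤ} {x : E m} :
    x ∈ interior (obstacle O k) ↔ x - intVec k ∈ interior O := by
  rw [obstacle_eq_preimage, ← Homeomorph.preimage_interior]; rfl

theorem mem_frontier_obstacle {k : Fin m → ℤ} {x : E m} :
    x ∈ frontier (obstacle O k) ↔ x - intVec k ∈ frontier O := by
  rw [obstacle_eq_preimage, ← Homeomorph.preimage_frontier]; rfl

theorem isOuterNormal_obstacle {k : Fin m → ℤ} {x n : E m} :
    IsOuterNormal (obstacle O k) x n ↔ IsOuterNormal O (x - intVec k) n := by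
  refine and_congr_right fun _ => ⟨fun h y hy => ?_, fun h y hy => ?_⟩
  · have := h _ (add_mem_obstacle (k := k) hy)
    rwa [show y - (x - intVec k) = y + intVec k - x by abel]
  · have := h _ (mem_obstacle.1 hy)
    rwa [show y - intVec k - (x - intVec k) = y - x by abel] at this

theorem obstacle_add {j k : Fin m → ℤ} {x : E m} :
    x + intVec j ∈ obstacle O (j + k) ↔ x ∈ obstacle O k := by
  rw [mem_obstacle, mem_obstacle, intVec_add, show x + intVec j - (intVec j + intVec k)
    = x - intVec k by abel]

theorem IsObstacle.nonempty (hO : IsObstacle O) : O.Nonempty :=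
  hO.nonempty_interior.mono interior_subset

theorem IsObstacle.convex (hO : IsObstacle O) : Convex ℝ O := hO.strictConvex.convex

theorem IsObstacle.isClosed (hO : IsObstacle O) : IsClosed O := hO.isCompact.isClosed

theorem convex_obstacle (hO : IsObstacle O) (k : Fin m → ℤ) : Convex ℝ (obstacle O k) := by
  have h := hO.convex.translate_preimage_right (-intVec k)
  have e : obstacle O k = (fun z => -intVec k + z) ⁻¹' O := by
    ext x; simp [mem_obstacle, sub_eq_neg_add]
  rwa [e]

theorem isCompact_obstacle (hO : IsObstacle O) (k : Fin m → ℤ) : IsCompact (obstacle O k) :=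
  (Homeomorph.subRight (intVec k)).isCompact_preimage.2 hO.isCompact

theorem frontier_obstacle_subset (hO : IsObstacle O) (k : Fin m → ℤ) :
    frontier (obstacle O k) ⊆ obstacle O k := (isCompact_obstacle hO k).isClosed.frontier_subset

theorem norm_sub_le_of_small {c : E m} {r : ℝ} (h : O ⊆ Metric.closedBall c r) {x y : E m}
    (hx : x ∈ O) (hy : y ∈ O) : ‖x - y‖ ≤ 2 * r := by
  have h1 := mem_closedBall_iff_norm.1 (h hx)
  have h2 := mem_closedBall_iff_norm.1 (h hy)
  calc ‖x - y‖ = ‖(x - c) - (y - c)‖ := by congr 1; abel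
    _ ≤ ‖x - c‖ + ‖y - c‖ := norm_sub_le _ _
    _ ≤ 2 * r := by linarith

/-- The only place where the radius bound √2/4 is used: the diameter is below √2/2. -/
theorem IsSmall.norm_sq_sub_lt (h : IsSmall O) {x y : E m} (hx : x ∈ O) (hy : y ∈ O) :
    ‖x - y‖ ^ 2 < 1 / 2 := by
  obtain ⟨c, r, hr, hs⟩ := h
  have h1 := norm_sub_le_of_small hs hx hy
  have h2 : (Real.sqrt 2) ^ 2 = 2 := Real.sq_sqrt (by norm_num)
  have h3 : 0 ≤ Real.sqrt 2 := Real.sqrt_nonneg 2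
  have h4 : ‖x - y‖ < Real.sqrt 2 / 2 := by linarith
  nlinarith [norm_nonneg (x - y)]

/-- A rational bound above √2/2. Since it is below 1, distinct obstacles are at least 1/4 apart. -/
theorem IsSmall.norm_sub_lt (h : IsSmall O) {x y : E m} (hx : x ∈ O) (hy : y ∈ O) :
    ‖x - y‖ < 3 / 4 := by
  nlinarith [norm_nonneg (x - y), h.norm_sq_sub_lt hx hy]

theorem IsSmall.dist_obstacle (h : IsSmall O) {x y : E m} {j k : Fin m → ℤ}
    (hx : x ∈ obstacle O j) (hy : y ∈ obstacle O k) :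
    ‖(y - x) - intVec (k - j)‖ < 3 / 4 := by
  have := h.norm_sub_lt (mem_obstacle.1 hy) (mem_obstacle.1 hx)
  rwa [intVec_sub, show y - x - (intVec k - intVec j) = y - intVec k - (x - intVec j) by abel]

theorem IsSmall.quarter_le (h : IsSmall O) {x y : E m} {j k : Fin m → ℤ} (hjk : k ≠ j)
    (hx : x ∈ obstacle O j) (hy : y ∈ obstacle O k) : 1 / 4 ≤ ‖y - x‖ := by
  have h1 := h.dist_obstacle hx hy
  have h2 := one_le_norm_intVec (sub_ne_zero.2 hjk)
  have h3 := norm_sub_norm_le (intVec (k - j)) (y - x)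
  rw [norm_sub_rev (intVec _)] at h3
  linarith

theorem IsSmall.eq_of_mem (h : IsSmall O) {x : E m} {j k : Fin m → ℤ}
    (hj : x ∈ obstacle O j) (hk : x ∈ obstacle O k) : j = k := by
  by_contra hne
  have := h.quarter_le hne hk hj
  norm_num at this

/-! ### Betweenness -/

theorem between_iff (hO : IsObstacle O) {i j k : Fin m → ℤ} :
    Between O i j k ↔ k ≠ i ∧ k ≠ j ∧ ∃ a ∈ O, ∃ b ∈ O, ∃ c ∈ O, ∃ t ∈ Set.Icc (0 : ℝ) 1,
      c + intVec k = (1 - t) • (a + intVec i) + t • (b + intVec j) := by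
  obtain ⟨o, ho⟩ := hO.nonempty
  unfold Between
  rw [(convex_obstacle hO i).convexHull_union (convex_obstacle hO j) ⟨_, add_mem_obstacle ho⟩
    ⟨_, add_mem_obstacle ho⟩]
  refine and_congr_right fun _ => and_congr_right fun _ => ⟨?_, ?_⟩
  · rintro ⟨x, hx, hx'⟩
    obtain ⟨a, ha, b, hb, hab⟩ := mem_convexJoin.1 hx'
    rw [segment_eq_image] at hab
    obtain ⟨t, ht, rfl⟩ := hab
    exact ⟨_, ha, _, hb, _, hx, t, ht, by simp⟩
  · rintro ⟨a, ha, b, hb, c, hc, t, ht, h⟩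
    refine ⟨c + intVec k, add_mem_obstacle hc, mem_convexJoin.2
      ⟨_, add_mem_obstacle ha, _, add_mem_obstacle hb, ?_⟩⟩
    rw [segment_eq_image, h]
    exact ⟨t, ht, rfl⟩

theorem between_add (hO : IsObstacle O) {i j k : Fin m → ℤ} (l : Fin m → ℤ) :
    Between O (l + i) (l + j) (l + k) ↔ Between O i j k := by
  rw [between_iff hO, between_iff hO]
  simp only [ne_eq, add_right_inj, intVec_add]
  refine and_congr_right fun _ => and_congr_right fun _ => ?_
  have key : ∀ (a b c : E m) (t : ℝ),
      c + (intVec l + intVec k) = (1 - t) • (a + (intVec l + intVec i))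
        + t • (b + (intVec l + intVec j)) ↔
      c + intVec k = (1 - t) • (a + intVec i) + t • (b + intVec j) := fun a b c t => by
    rw [← add_right_inj (intVec l) (b := c + intVec k)]
    refine Eq.congr (by abel) ?_
    module
  simp only [key]

/-- Reduces betweenness to lattice points near a segment: by convexity the vector in question is a
difference of two points of `O`. -/
theorem Between.exists_dist_lt (hO : IsObstacle O) (hs : IsSmall O) {i j k : Fin m → ℤ}
    (h : Between O i j k) : ∃ t ∈ Set.Icc (0 : ℝ) 1,
      ‖(1 - t) • intVec i + t • intVec j - intVec k‖ ^ 2 < 1 / 2 := by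
  obtain ⟨-, -, a, ha, b, hb, c, hc, t, ht, e⟩ := (between_iff hO).1 h
  have hab : (1 - t) • a + t • b ∈ O := hO.convex ha hb (by linarith [ht.2]) ht.1 (by ring)
  refine ⟨t, ht, ?_⟩
  have := hs.norm_sq_sub_lt hc hab
  rwa [show (1 - t) • intVec i + t • intVec j - intVec k = c - ((1 - t) • a + t • b) by
    rw [eq_sub_iff_add_eq, sub_add_eq_add_sub, sub_eq_iff_eq_add, e]; module]

/-! ### Admissibility in terms of steps -/

/-- The step `d`, from `O_0` to `O_d`, is possible in an admissible sequence. -/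
def IsStep (O : Set (E m)) (d : Fin m → ℤ) : Prop := d ≠ 0 ∧ ∀ j, ¬ Between O 0 d j

/-- The steps `d`, `e` may follow one another in an admissible sequence. -/
def Follows (O : Set (E m)) (d e : Fin m → ℤ) : Prop := ¬ Between O 0 (d + e) d

/-- The squared distance from `d` to the point `t (d + e)` is at least `(1-t)² + t² ≥ 1/2`, because
the cross term has the right sign. This matches the squared diameter bound exactly. -/
theorem follows_of_inner_nonpos (hO : IsObstacle O) (hs : IsSmall O) {d e : Fin m → ℤ}
    (h : ∑ i, d i * e i ≤ 0) : Follows O d e := by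
  intro hb
  have hd : d ≠ 0 := hb.1
  have he : e ≠ 0 := by rintro rfl; exact hb.2.1 (by simp)
  obtain ⟨t, ht, hlt⟩ := hb.exists_dist_lt hO hs
  have hin : inner ℝ (intVec d) (intVec e) ≤ 0 := by
    rw [inner_intVec]; exact_mod_cast h
  have e1 : (1 - t) • intVec (0 : Fin m → ℤ) + t • intVec (d + e) - intVec d
      = t • intVec e - (1 - t) • intVec d := by
    rw [intVec_add, intVec_zero]; module
  rw [e1, norm_sub_sq_real, norm_smul, norm_smul, real_inner_smul_left, real_inner_smul_right,
    mul_pow, mul_pow, Real.norm_eq_abs, Real.norm_eq_abs, sq_abs, sq_abs, real_inner_comm] at hlt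
  have h1 := one_le_norm_sq_intVec hd
  have h2 := one_le_norm_sq_intVec he
  have h3 : 0 ≤ t * ((1 - t) * -inner ℝ (intVec d) (intVec e)) :=
    mul_nonneg ht.1 (mul_nonneg (by linarith [ht.2]) (by linarith))
  nlinarith [sq_nonneg (2 * t - 1), sq_nonneg t, sq_nonneg (1 - t)]

/-- The inner product `p` of `j` with the unit step is an integer. If `p ≤ 0`, then `j` is at
distance at least 1 from the segment because `‖j‖ ≥ 1`; if `p ≥ 1`, because `j` is at distance at
least 1 from the other endpoint. -/
theorem isStep_single (hO : IsObstacle O) (hs : IsSmall O) (i : Fin m) {a : ℤ}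
    (ha : a = 1 ∨ a = -1) : IsStep O (Pi.single i a) := by
  have haa : (a : ℝ) * a = 1 := by rcases ha with rfl | rfl <;> norm_num
  have ha0 : a ≠ 0 := by rcases ha with rfl | rfl <;> norm_num
  refine ⟨by simpa using ha0, fun j hb => ?_⟩
  obtain ⟨t, ht, hlt⟩ := hb.exists_dist_lt hO hs
  have h1 := one_le_norm_sq_intVec hb.1
  have h2 := one_le_norm_sq_intVec (sub_ne_zero.2 hb.2.1)
  have hd : ‖intVec (Pi.single i a : Fin m → ℤ)‖ ^ 2 = 1 := by
    rw [← real_inner_self_eq_norm_sq, inner_intVec]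
    simp [Pi.single_apply, haa]
  set p : ℤ := ∑ l, (Pi.single i a : Fin m → ℤ) l * j l with hp
  have hin := inner_intVec (Pi.single i a : Fin m → ℤ) j
  rw [← hp] at hin
  rw [intVec_sub, norm_sub_sq_real, hd, real_inner_comm, hin] at h2
  rw [intVec_zero, smul_zero, zero_add, norm_sub_sq_real, norm_smul, mul_pow, hd,
    real_inner_smul_left, hin, Real.norm_eq_abs, sq_abs] at hlt
  rcases le_or_gt p 0 with h0 | h0
  · have : (p : ℝ) ≤ 0 := by exact_mod_cast h0
    nlinarith [mul_nonneg ht.1 (neg_nonneg.2 this), sq_nonneg t]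
  · have : (1 : ℝ) ≤ p := by exact_mod_cast h0
    nlinarith [mul_nonneg (sub_nonneg.2 ht.2) (sub_nonneg.2 this), sq_nonneg (1 - t)]

/-- Any two admissible words can be connected by two steps. -/
theorem exists_connection (hm : 2 ≤ m) (hO : IsObstacle O) (hs : IsSmall O)
    {P W : List (Fin m → ℤ)} (hP : P.IsChain (Follows O)) (hW : W.IsChain (Follows O)) :
    ∃ d e, IsStep O d ∧ IsStep O e ∧ (P ++ ([d, e] ++ W)).IsChain (Follows O) := by
  have sgn : ∀ b : ℤ, ∃ a : ℤ, (a = 1 ∨ a = -1) ∧ b * a ≤ 0 := fun b => by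
    rcases le_total b 0 with h | h
    · exact ⟨1, Or.inl rfl, by simpa⟩
    · exact ⟨-1, Or.inr rfl, by simpa⟩
  let i0 : Fin m := ⟨0, by omega⟩
  let i1 : Fin m := ⟨1, by omega⟩
  have hne : i0 ≠ i1 := by simp [i0, i1]
  -- The signs make the first new step non-acute to the end of `P` and the second to the start of
  -- `W`; the two new steps are orthogonal, which needs two coordinates. The default 0 serves an
  -- empty word, where there is nothing to check.
  obtain ⟨a, ha, ha'⟩ := sgn ((P.getLast?.getD 0) i0)
  obtain ⟨b, hb, hb'⟩ := sgn ((W.head?.getD 0) i1)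
  refine ⟨Pi.single i0 a, Pi.single i1 b, isStep_single hO hs _ ha, isStep_single hO hs _ hb, ?_⟩
  rw [List.isChain_append, List.isChain_append]
  refine ⟨hP, ⟨?_, hW, ?_⟩, ?_⟩
  · rw [List.isChain_pair]
    apply follows_of_inner_nonpos hO hs
    simp [Pi.single_apply, hne.symm]
  · intro x hx y hy
    apply follows_of_inner_nonpos hO hs
    simp only [List.getLast?_cons_cons, List.getLast?_singleton, Option.mem_def,
      Option.some.injEq] at hx
    subst hx
    rw [Option.mem_def] at hy
    simpa [hy, Pi.single_apply, mul_comm] using hb'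
  · intro x hx y hy
    apply follows_of_inner_nonpos hO hs
    simp only [List.cons_append, List.head?_cons, Option.mem_def, Option.some.injEq] at hy
    subst hy
    rw [Option.mem_def] at hx
    simpa [hx, Pi.single_apply] using ha'

/-! ### Boundedness of admissible steps -/

/-- Multiples of a vector come close to the lattice. -/
theorem exists_nat_smul_near_lattice (ρ : ℝ) (hρ : 0 < ρ) :
    ∃ N : ℕ, ∀ v : E m, ∃ q : ℕ, 1 ≤ q ∧ q ≤ N ∧ ∃ j : Fin m → ℤ, ‖(q : ℝ) • v - intVec j‖ < ρ := by
  have hK : IsCompact (Metric.closedBall (0 : E m) (Real.sqrt m)) := isCompact_closedBall _ _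
  obtain ⟨t, -, ht⟩ := hK.elim_finite_subcover_image (b := Set.univ)
    (c := fun x : E m => Metric.ball x (ρ / 2)) (fun _ _ => Metric.isOpen_ball)
    (fun x _ => Set.mem_biUnion (Set.mem_univ x) (Metric.mem_ball_self (by positivity)))
  obtain ⟨tfin, ht⟩ := ht
  let s := tfin.toFinset
  refine ⟨s.card + 1, fun v => ?_⟩
  let fl : ℕ → Fin m → ℤ := fun n i => ⌊(n : ℝ) * v i⌋
  let f : ℕ → E m := fun n => (n : ℝ) • v - intVec (fl n)
  have hf : ∀ n, ∃ x ∈ s, ‖f n - x‖ < ρ / 2 := fun n => by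
    have h1 : f n ∈ Metric.closedBall (0 : E m) (Real.sqrt m) := by
      rw [mem_closedBall_zero_iff, EuclideanSpace.norm_eq]
      apply Real.sqrt_le_sqrt
      calc ∑ i, ‖f n i‖ ^ 2 ≤ ∑ _i : Fin m, (1 : ℝ) := Finset.sum_le_sum fun i _ => by
            have e : f n i = Int.fract ((n : ℝ) * v i) := by
              simp only [f, fl, PiLp.sub_apply, PiLp.smul_apply, smul_eq_mul, intVec_apply]
              exact Int.self_sub_floor _
            rw [e, Real.norm_eq_abs, sq_abs]
            have := Int.fract_nonneg ((n : ℝ) * v i)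
            have := Int.fract_lt_one ((n : ℝ) * v i)
            nlinarith
        _ = m := by simp
    obtain ⟨x, hx, hx'⟩ := Set.mem_iUnion₂.1 (ht h1)
    exact ⟨x, by simpa [s] using hx, by simpa [dist_eq_norm] using hx'⟩
  choose g hg hg' using hf
  -- Pigeonhole: two of the `s.card + 1` vectors of fractional parts share a ball of radius `ρ / 2`,
  -- and the difference of the multipliers is the required `q`. The cover does not depend on `v`, so
  -- neither does the bound.
  obtain ⟨a, ha, b, hb, hab, heq⟩ := Finset.exists_ne_map_eq_of_card_lt_of_maps_to
    (s := Finset.range (s.card + 1)) (t := s) (by simp) (f := g) (fun n _ => hg n)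
  wlog hlt : a < b generalizing a b
  · exact this b hb a ha hab.symm heq.symm (by omega)
  rw [Finset.mem_range] at ha hb
  refine ⟨b - a, by omega, by omega, fl b - fl a, ?_⟩
  have e : ((b - a : ℕ) : ℝ) • v - intVec (fl b - fl a) = (f b - g b) - (f a - g a) := by
    rw [heq, intVec_sub, Nat.cast_sub hlt.le]
    simp only [f]
    module
  rw [e]
  calc _ ≤ ‖f b - g b‖ + ‖f a - g a‖ := norm_sub_le _ _
    _ < ρ := by linarith [hg' a, hg' b]

/-- A long segment of direction `d` passes close to a lattice point `j` at a distance `q ≤ N` from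
its start, so a ball inside `O` translated by `j` blocks it. The precision 1/2 keeps `j` away from
both ends, which are at distance at least 1 from that point of the segment. -/
theorem exists_bound_isStep (hO : IsObstacle O) :
    ∃ R : ℝ, ∀ d, IsStep O d → ‖intVec d‖ ≤ R := by
  obtain ⟨o, ho⟩ := hO.nonempty_interior
  obtain ⟨ρ, hρ, hball⟩ := Metric.mem_nhds_iff.1 (mem_interior_iff_mem_nhds.1 ho)
  obtain ⟨N, hN⟩ := exists_nat_smul_near_lattice (m := m) (min ρ (1 / 2)) (by positivity)
  refine ⟨N + 1, fun d hd => ?_⟩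
  by_contra! hlt
  set D := ‖intVec d‖ with hD
  have hD0 : 0 < D := by have : (0 : ℝ) ≤ N := N.cast_nonneg; linarith
  obtain ⟨q, hq1, hq2, j, hj⟩ := hN (D⁻¹ • intVec d)
  have hq1' : (1 : ℝ) ≤ q := by exact_mod_cast hq1
  have hq2' : (q : ℝ) ≤ N := by exact_mod_cast hq2
  have hj1 := hj.trans_le (min_le_left _ _)
  have hj2 := hj.trans_le (min_le_right _ _)
  have hv : ∀ c : ℝ, ‖c • (D⁻¹ • intVec d)‖ = |c| := fun c => by
    rw [norm_smul, norm_smul, norm_inv, ← hD, Real.norm_eq_abs, Real.norm_eq_abs,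
      abs_of_pos hD0, inv_mul_cancel₀ hD0.ne', mul_one]
  refine hd.2 j ((between_iff hO).2 ⟨?_, ?_, o, interior_subset ho, o, interior_subset ho,
    o + ((q : ℝ) • D⁻¹ • intVec d - intVec j), ?_, q * D⁻¹, ⟨by positivity, ?_⟩, ?_⟩)
  · rintro rfl
    rw [intVec_zero, sub_zero, hv, abs_of_pos (by linarith)] at hj2
    linarith
  · rintro rfl
    have e : (q : ℝ) • D⁻¹ • intVec j - intVec j = (q - D) • (D⁻¹ • intVec j) := by
      rw [sub_smul, smul_smul D, mul_inv_cancel₀ hD0.ne', one_smul]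
    rw [e, hv, abs_of_neg (by linarith)] at hj2
    linarith
  · exact hball (by simpa [dist_eq_norm] using hj1)
  · rw [← div_eq_mul_inv, div_le_one hD0]; linarith
  · rw [intVec_zero, add_zero]; module

/-! ### Boundary points -/

/-- The normal is the normalized gradient of the defining function: directions of negative
derivative enter the interior, and convexity makes the gradient an outer normal. A second unit
normal `n'` is impossible, since `n' - n` would enter the interior while having positive inner
product with `n'`. -/
theorem exists_outerNormal_of_mem_frontier (hO : IsObstacle O) {x : E m} (hx : x ∈ frontier O) :
    ∃ n, IsOuterNormal O x n ∧ (∀ n', IsOuterNormal O x n' → n' = n) ∧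
      ∀ w, inner ℝ n w < 0 → ∀ᶠ t in 𝓝[>] (0 : ℝ), x + t • w ∈ interior O := by
  obtain ⟨φ, hφ, hφ0, hφ1, hφO⟩ := hO.smooth x hx
  set g : E m := (InnerProductSpace.toDual ℝ (E m)).symm (fderiv ℝ φ x) with hg
  have hg0 : g ≠ 0 := by simpa [hg] using hφ1
  have hgn : 0 < ‖g‖ := norm_pos_iff.2 hg0
  have hgi : ∀ w, fderiv ℝ φ x w = inner ℝ g w := fun w => by simp [hg]
  have hline : ∀ w : E m, HasDerivAt (fun t : ℝ => φ (x + t • w)) (inner ℝ g w) 0 := fun w => by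
    have h1 : HasFDerivAt φ (fderiv ℝ φ x) (x + (0 : ℝ) • w) := by
      simpa using (hφ.differentiableAt (by norm_num)).hasFDerivAt
    have h2 : HasDerivAt (fun t : ℝ => x + t • w) w 0 := by
      simpa using ((hasDerivAt_id (0 : ℝ)).smul_const w).const_add x
    rw [← hgi]
    exact h1.comp_hasDerivAt (0 : ℝ) h2
  have hcont : ∀ w : E m, Tendsto (fun t : ℝ => x + t • w) (𝓝[>] 0) (𝓝 x) := fun w => by
    have : Continuous fun t : ℝ => x + t • w := by fun_prop
    simpa using (this.tendsto 0).mono_left nhdsWithin_le_nhds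
  have hslope : ∀ w : E m, Tendsto (fun t : ℝ => t⁻¹ * φ (x + t • w)) (𝓝[>] 0)
      (𝓝 (inner ℝ g w)) := fun w => by
    have := (hasDerivAt_iff_tendsto_slope_zero.1 (hline w)).mono_left
      (nhdsWithin_mono 0 (show Set.Ioi (0 : ℝ) ⊆ {0}ᶜ from fun t ht => (Set.mem_Ioi.1 ht).ne'))
    simpa [hφ0] using this
  have hint : ∀ᶠ y in 𝓝 x, φ y < 0 → y ∈ interior O := by
    have hc : ∀ᶠ y in 𝓝 x, ContinuousAt φ y := by
      have := hφ.eventually (by simp)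
      exact this.mono fun y hy => hy.continuousAt
    filter_upwards [hφO.eventually_nhds, hc] with y hy hcy hlt
    rw [mem_interior_iff_mem_nhds]
    filter_upwards [hy, hcy.eventually_lt continuousAt_const hlt] with z hz hz'
    exact hz.2 hz'.le
  have hin : ∀ w, inner ℝ g w < 0 → ∀ᶠ t in 𝓝[>] (0 : ℝ), x + t • w ∈ interior O := fun w hw => by
    filter_upwards [(hslope w).eventually_lt_const hw, (hcont w).eventually hint,
      self_mem_nhdsWithin] with t h1 h2 (ht : 0 < t)
    exact h2 (by
      by_contra! h
      exact absurd h1 (not_lt.2 (by positivity)))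
  have hout : ∀ y ∈ O, inner ℝ g (y - x) ≤ 0 := fun y hy => by
    refine le_of_tendsto (hslope (y - x)) ?_
    have h1 : ∀ᶠ t in 𝓝[>] (0 : ℝ), t < 1 := nhdsWithin_le_nhds (eventually_lt_nhds one_pos)
    filter_upwards [(hcont (y - x)).eventually hφO, h1, self_mem_nhdsWithin] with t h1 h2 (ht : 0 < t)
    have : x + t • (y - x) ∈ O :=
      hO.convex.add_smul_sub_mem (hO.isClosed.frontier_subset hx) hy ⟨ht.le, h2.le⟩
    exact mul_nonpos_of_nonneg_of_nonpos (by positivity) (h1.1 this)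
  have hsm : ∀ w, inner ℝ (‖g‖⁻¹ • g) w = ‖g‖⁻¹ * inner ℝ g w := fun w => real_inner_smul_left _ _ _
  have hin' : ∀ w, inner ℝ (‖g‖⁻¹ • g) w < 0 →
      ∀ᶠ t in 𝓝[>] (0 : ℝ), x + t • w ∈ interior O := fun w hw => by
    rw [hsm] at hw
    exact hin w (by
      by_contra! h
      exact absurd hw (not_lt.2 (by positivity)))
  have hnorm : ‖‖g‖⁻¹ • g‖ = 1 := norm_smul_inv_norm hg0
  refine ⟨‖g‖⁻¹ • g, ⟨hnorm, fun y hy => ?_⟩, fun n' hn' => ?_, hin'⟩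
  · rw [hsm]
    exact mul_nonpos_of_nonneg_of_nonpos (by positivity) (hout y hy)
  · by_contra hne
    have hlt : inner ℝ (‖g‖⁻¹ • g) n' < 1 :=
      (inner_lt_one_iff_real_of_norm_eq_one hnorm hn'.1).2 (Ne.symm hne)
    have h1 := hin' (n' - ‖g‖⁻¹ • g) (by
      rw [inner_sub_right, real_inner_self_eq_norm_sq, hnorm]; linarith)
    obtain ⟨t, ht, ht0⟩ := (h1.and self_mem_nhdsWithin).exists
    have ht0 : 0 < t := ht0
    have h2 := hn'.2 _ (interior_subset ht)
    rw [add_sub_cancel_left, real_inner_smul_right, inner_sub_right, real_inner_self_eq_norm_sq,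
      hn'.1, real_inner_comm] at h2
    nlinarith

theorem mem_frontier_of_isOuterNormal {C : Set (E m)} {x n : E m} (hx : x ∈ C)
    (hn : IsOuterNormal C x n) : x ∈ frontier C := by
  refine ⟨subset_closure hx, fun hi => ?_⟩
  have hc : Tendsto (fun t : ℝ => x + t • n) (𝓝[>] 0) (𝓝 x) := by
    have : Continuous fun t : ℝ => x + t • n := by fun_prop
    simpa using (this.tendsto 0).mono_left nhdsWithin_le_nhds
  obtain ⟨t, ht, ht0⟩ := ((hc.eventually (mem_interior_iff_mem_nhds.1 hi)).and
    self_mem_nhdsWithin).exists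
  have ht0 : 0 < t := ht0
  have := hn.2 _ ht
  rw [add_sub_cancel_left, real_inner_smul_right, real_inner_self_eq_norm_sq, hn.1] at this
  linarith

theorem exists_outerNormal_obstacle (hO : IsObstacle O) {k : Fin m → ℤ} {x : E m}
    (hx : x ∈ frontier (obstacle O k)) :
    ∃ n, IsOuterNormal (obstacle O k) x n ∧ (∀ n', IsOuterNormal (obstacle O k) x n' → n' = n) ∧
      ∀ w, inner ℝ n w < 0 → ∀ᶠ t in 𝓝[>] (0 : ℝ), x + t • w ∈ interior (obstacle O k) := by
  obtain ⟨n, h1, h2, h3⟩ := exists_outerNormal_of_mem_frontier hO (mem_frontier_obstacle.1 hx)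
  refine ⟨n, isOuterNormal_obstacle.2 h1, fun n' hn' => h2 n' (isOuterNormal_obstacle.1 hn'),
    fun w hw => (h3 w hw).mono fun t ht => mem_interior_obstacle.2 ?_⟩
  rwa [add_sub_right_comm]

/-! ### Reflections -/

theorem reflect_reflect {n : E m} (hn : ‖n‖ = 1) (v : E m) : reflect n (reflect n v) = v := by
  simp only [reflect, inner_sub_left, real_inner_smul_left, real_inner_self_eq_norm_sq, hn]
  module

theorem inner_reflect {n : E m} (hn : ‖n‖ = 1) (v : E m) :
    inner ℝ (reflect n v) n = -inner ℝ v n := by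
  simp only [reflect, inner_sub_left, real_inner_smul_left, real_inner_self_eq_norm_sq, hn]
  ring

theorem reflect_eq_self {n v : E m} (h : inner ℝ v n = 0) : reflect n v = v := by
  simp [reflect, h]

/-- A unit vector that differs from another one by a multiple of `n` is its reflection. -/
theorem eq_reflect_of_sub_eq_smul {n v w : E m} {c : ℝ} (hn : ‖n‖ = 1) (hvw : ‖v‖ = ‖w‖)
    (hc : 0 < c) (h : v - w = c • n) : v = reflect n w ∧ inner ℝ v n = c / 2 := by
  obtain rfl : v = w + c • n := by rw [← h]; abel
  have h1 : ‖w + c • n‖ ^ 2 = ‖w‖ ^ 2 := by rw [hvw]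
  rw [norm_add_sq_real, norm_smul, real_inner_smul_right, hn, Real.norm_eq_abs, mul_one, sq_abs]
    at h1
  have h2 : c = -(2 * inner ℝ w n) := by
    have : c * (c + 2 * inner ℝ w n) = 0 := by linarith
    rcases mul_eq_zero.1 this with h | h <;> linarith
  constructor
  · rw [reflect, sub_eq_add_neg, ← neg_smul, ← h2]
  · rw [inner_add_left, real_inner_smul_left, real_inner_self_eq_norm_sq, hn]
    linarith

/-! ### Trajectories -/

/-- The outgoing velocity `v` at the point `x` is obtained from the incoming velocity `w` by the
reflection law. -/
def ReflectionLaw (O : Set (E m)) (x v w : E m) : Prop :=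
  ((∀ k, x ∉ frontier (obstacle O k)) → v = w) ∧
    ∀ k n, x ∈ frontier (obstacle O k) → IsOuterNormal (obstacle O k) x n → v = reflect n w

theorem ReflectionLaw.outgoing_unique (hO : IsObstacle O) {x v v' w : E m}
    (h : ReflectionLaw O x v w) (h' : ReflectionLaw O x v' w) : v = v' := by
  by_cases hx : ∀ k, x ∉ frontier (obstacle O k)
  · rw [h.1 hx, h'.1 hx]
  · push Not at hx
    obtain ⟨k, hk⟩ := hx
    obtain ⟨n, hn, -⟩ := exists_outerNormal_obstacle hO hk
    rw [h.2 k n hk hn, h'.2 k n hk hn]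

/-- Reflection is an involution, so the past is determined as well as the future. -/
theorem ReflectionLaw.incoming_unique (hO : IsObstacle O) {x v w w' : E m}
    (h : ReflectionLaw O x v w) (h' : ReflectionLaw O x v w') : w = w' := by
  by_cases hx : ∀ k, x ∉ frontier (obstacle O k)
  · rw [← h.1 hx, ← h'.1 hx]
  · push Not at hx
    obtain ⟨k, hk⟩ := hx
    obtain ⟨n, hn, -⟩ := exists_outerNormal_obstacle hO hk
    rw [← reflect_reflect hn.1 w, ← h.2 k n hk hn, h'.2 k n hk hn, reflect_reflect hn.1]

namespace Trajectory

theorem exists_motion (T : Trajectory O) (t : ℝ) : ∃ ε > 0, ∃ w : E m,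
    (∀ s ∈ Set.Icc t (t + ε), T.pos s = T.pos t + (s - t) • T.vel t) ∧
    (∀ s ∈ Set.Icc (t - ε) t, T.pos s = T.pos t + (s - t) • w) ∧
    ReflectionLaw O (T.pos t) (T.vel t) w := T.motion t

theorem continuous_pos (T : Trajectory O) : Continuous T.pos := by
  refine continuous_iff_continuousAt.2 fun t => ?_
  obtain ⟨ε, hε, w, h1, h2, -⟩ := T.exists_motion t
  refine tendsto_iff_norm_sub_tendsto_zero.2 ?_
  refine squeeze_zero' (g := fun s => (1 + ‖w‖) * |s - t|) (.of_forall fun _ => norm_nonneg _) ?_ ?_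
  · filter_upwards [Icc_mem_nhds (sub_lt_self t hε) (lt_add_of_pos_right t hε)] with s hs
    rcases le_total t s with h | h
    · rw [h1 s ⟨h, hs.2⟩, add_sub_cancel_left, norm_smul, T.norm_vel, Real.norm_eq_abs]
      nlinarith [abs_nonneg (s - t), norm_nonneg w]
    · rw [h2 s ⟨hs.1, h⟩, add_sub_cancel_left, norm_smul, Real.norm_eq_abs]
      nlinarith [abs_nonneg (s - t), norm_nonneg w]
  · have : Continuous fun s => (1 + ‖w‖) * |s - t| := by fun_prop
    simpa using this.tendsto t

/-- The velocity is the right derivative of the position. -/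
theorem vel_eq_of_right (T : Trajectory O) {t δ : ℝ} {p v : E m} (hδ : 0 < δ)
    (h : ∀ s ∈ Set.Ico t (t + δ), T.pos s = p + (s - t) • v) : T.vel t = v := by
  obtain ⟨ε, hε, w, h1, -, -⟩ := T.exists_motion t
  have hp := h t ⟨le_rfl, by linarith⟩
  set s := min ε (δ / 2) with hs
  have hs0 : 0 < s := by positivity
  have e1 := h1 (t + s) ⟨by linarith, by linarith [min_le_left ε (δ / 2)]⟩
  have e2 := h (t + s) ⟨by linarith, by linarith [min_le_right ε (δ / 2)]⟩
  rw [e1, hp, sub_self, zero_smul, add_zero, add_sub_cancel_left, add_right_inj] at e2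
  exact smul_right_injective _ hs0.ne' e2

/-- The set of times of agreement is open and closed in ℝ, since the law of motion determines both
half-neighbourhoods of each time. -/
theorem eq_of_eq_at (hO : IsObstacle O) {T T' : Trajectory O} {a : ℝ}
    (hp : T.pos a = T'.pos a) (hv : T.vel a = T'.vel a) (t : ℝ) :
    T.pos t = T'.pos t ∧ T.vel t = T'.vel t := by
  let A : Set ℝ := {t | T.pos t = T'.pos t ∧ T.vel t = T'.vel t}
  have hopen : IsOpen A := by
    refine isOpen_iff_mem_nhds.2 fun t ht => ?_
    obtain ⟨ε, hε, w, h1, h2, h3⟩ := T.exists_motion t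
    obtain ⟨ε', hε', w', h1', h2', h3'⟩ := T'.exists_motion t
    have hw : w = w' := by
      rw [← ht.1, ← ht.2] at h3'
      exact h3.incoming_unique hO h3'
    have hpos : ∀ s ∈ Set.Icc (t - min ε ε') (t + min ε ε'), T.pos s = T'.pos s := fun s hs => by
      have l1 := min_le_left ε ε'
      have l2 := min_le_right ε ε'
      rcases le_total t s with h | h
      · rw [h1 s ⟨h, by linarith [hs.2]⟩, h1' s ⟨h, by linarith [hs.2]⟩, ht.1, ht.2]
      · rw [h2 s ⟨by linarith [hs.1], h⟩, h2' s ⟨by linarith [hs.1], h⟩, ht.1, hw]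
    have hδ : 0 < min ε ε' := by positivity
    filter_upwards [Ioo_mem_nhds (sub_lt_self t hδ) (lt_add_of_pos_right t hδ)] with s hs
    refine ⟨hpos s (Set.Ioo_subset_Icc_self hs), ?_⟩
    obtain ⟨η, hη, w', hs1, -, -⟩ := T'.exists_motion s
    have hη' : 0 < min η (t + min ε ε' - s) := lt_min hη (by linarith [hs.2])
    refine T.vel_eq_of_right (p := T'.pos s) hη' fun r hr => ?_
    rw [hpos r ⟨by linarith [hs.1, hr.1], by
      linarith [hr.2, min_le_right η (t + min ε ε' - s)]⟩]
    exact hs1 r ⟨hr.1, by linarith [hr.2, min_le_left η (t + min ε ε' - s)]⟩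
  have hclosed : IsClosed A := by
    refine isClosed_of_closure_subset fun t ht => ?_
    have hpt : T.pos t = T'.pos t := by
      have hc : IsClosed {t | T.pos t = T'.pos t} :=
        isClosed_eq T.continuous_pos T'.continuous_pos
      exact closure_minimal (fun s hs => hs.1) hc ht
    obtain ⟨ε, hε, w, h1, h2, h3⟩ := T.exists_motion t
    obtain ⟨ε', hε', w', h1', h2', h3'⟩ := T'.exists_motion t
    have hδ : 0 < min ε ε' := by positivity
    obtain ⟨s, hs, hsA⟩ := mem_closure_iff_nhds.1 ht _
      (Ioo_mem_nhds (sub_lt_self t hδ) (lt_add_of_pos_right t hδ))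
    have l1 := min_le_left ε ε'
    have l2 := min_le_right ε ε'
    refine ⟨hpt, ?_⟩
    -- Agreement at a later time gives equal outgoing velocities at once; agreement at an earlier
    -- time gives equal incoming velocities, and then the reflection law applies.
    rcases lt_trichotomy t s with h | rfl | h
    · have e := hsA.1
      rw [h1 s ⟨h.le, by linarith [hs.2]⟩, h1' s ⟨h.le, by linarith [hs.2]⟩, hpt,
        add_right_inj] at e
      exact smul_right_injective _ (sub_pos.2 h).ne' e
    · exact hsA.2
    · have e := hsA.1
      rw [h2 s ⟨by linarith [hs.1], h.le⟩, h2' s ⟨by linarith [hs.1], h.le⟩, hpt,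
        add_right_inj] at e
      obtain rfl := smul_right_injective _ (sub_neg.2 h).ne e
      rw [← hpt] at h3'
      exact h3.outgoing_unique hO h3'
  exact Set.eq_univ_iff_forall.1 (IsClopen.eq_univ ⟨hclosed, hopen⟩ ⟨a, hp, hv⟩ : A = Set.univ) t

/-- A velocity pointing strictly inwards would carry the point into the interior, so `vel` is always
post-collision. -/
theorem inner_vel_nonneg (hO : IsObstacle O) (T : Trajectory O) {t : ℝ} {k : Fin m → ℤ} {n : E m}
    (hx : T.pos t ∈ frontier (obstacle O k)) (hn : IsOuterNormal (obstacle O k) (T.pos t) n) :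
    0 ≤ inner ℝ (T.vel t) n := by
  obtain ⟨n', -, huniq, hin⟩ := exists_outerNormal_obstacle hO hx
  obtain rfl := huniq n hn
  by_contra! h
  rw [real_inner_comm] at h
  obtain ⟨ε, hε, w, h1, -⟩ := T.exists_motion t
  obtain ⟨s, ⟨hs, hsε⟩, hs0⟩ := (((hin _ h).and
    (nhdsWithin_le_nhds (eventually_lt_nhds hε))).and self_mem_nhdsWithin).exists
  have hs0 : 0 < s := hs0
  have := h1 (t + s) ⟨by linarith, by linarith⟩
  rw [add_sub_cancel_left] at this
  exact T.outside (t + s) k (this ▸ hs)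

theorem eq_of_not_reflectsAt (hO : IsObstacle O) (T : Trajectory O) {t : ℝ} {w : E m}
    (hl : ReflectionLaw O (T.pos t) (T.vel t) w) (h : ∀ j, ¬ T.ReflectsAt t j) : T.vel t = w := by
  by_cases hx : ∀ k, T.pos t ∉ frontier (obstacle O k)
  · exact hl.1 hx
  · push Not at hx
    obtain ⟨k, hk⟩ := hx
    obtain ⟨n, hn, -⟩ := exists_outerNormal_obstacle hO hk
    have h0 : inner ℝ (T.vel t) n = 0 :=
      le_antisymm (not_lt.1 fun hlt => h k ⟨hk, n, hn, hlt⟩) (T.inner_vel_nonneg hO hk hn)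
    have h1 := hl.2 k n hk hn
    rw [← reflect_reflect hn.1 w, ← h1, reflect_eq_self h0]

/-- Between reflections, the trajectory is a straight line. -/
theorem straight (hO : IsObstacle O) (T : Trajectory O) {a b : ℝ} (hab : a < b)
    (h : ∀ s ∈ Set.Ioo a b, ∀ j, ¬ T.ReflectsAt s j) :
    T.pos b = T.pos a + (b - a) • T.vel a ∧ ReflectionLaw O (T.pos b) (T.vel b) (T.vel a) := by
  have key : ∀ s ∈ Set.Ico a b, T.pos s = T.pos a + (s - a) • T.vel a ∧ T.vel s = T.vel a := by
    intro s hs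
    -- "On the same line with the same velocity" holds locally and is symmetric and transitive,
    -- hence it spreads over the connected interval.
    refine isPreconnected_Ico.induction₂ (s := Set.Ico a b)
      (fun x y => T.pos y = T.pos x + (y - x) • T.vel x ∧ T.vel y = T.vel x) ?_ ?_ ?_
      ⟨le_rfl, hab⟩ hs
    · intro x hx
      obtain ⟨ε, hε, w, h1, h2, h3⟩ := T.exists_motion x
      filter_upwards [nhdsWithin_le_nhds (Ioo_mem_nhds (sub_lt_self x hε)
        (lt_add_of_pos_right x hε)), self_mem_nhdsWithin] with y hy hyab
      rcases le_or_gt x y with hxy | hxy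
      · refine ⟨h1 y ⟨hxy, hy.2.le⟩, T.vel_eq_of_right (p := T.pos x + (y - x) • T.vel x)
          (sub_pos.2 hy.2) fun r hr => ?_⟩
        rw [h1 r ⟨hxy.trans hr.1, by linarith [hr.2]⟩]
        module
      · have hw : T.vel x = w :=
          T.eq_of_not_reflectsAt hO h3 (h x ⟨hyab.1.trans_lt hxy, hx.2⟩)
        refine ⟨hw ▸ h2 y ⟨hy.1.le, hxy.le⟩, T.vel_eq_of_right (p := T.pos x + (y - x) • T.vel x)
          (sub_pos.2 hxy) fun r hr => ?_⟩
        rw [h2 r ⟨hy.1.le.trans hr.1, by linarith [hr.2]⟩, hw]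
        module
    · rintro x y z - - - ⟨h1, h2⟩ ⟨h3, h4⟩
      exact ⟨by rw [h3, h1, h2]; module, h4.trans h2⟩
    · rintro x y - - ⟨h1, h2⟩
      exact ⟨by rw [h1, h2]; module, h2.symm⟩
  have hb : T.pos b = T.pos a + (b - a) • T.vel a := by
    have hc : IsClosed {s | T.pos s = T.pos a + (s - a) • T.vel a} :=
      isClosed_eq T.continuous_pos (by fun_prop)
    refine closure_minimal (fun s hs => (key s hs).1) hc ?_
    rw [closure_Ico hab.ne]
    exact ⟨hab.le, le_rfl⟩
  refine ⟨hb, ?_⟩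
  obtain ⟨ε, hε, w, h1, h2, h3⟩ := T.exists_motion b
  have hδ : 0 < min ε (b - a) := lt_min hε (sub_pos.2 hab)
  have e1 := h2 (b - min ε (b - a)) ⟨by linarith [min_le_left ε (b - a)], by linarith⟩
  rw [(key _ ⟨by linarith [min_le_right ε (b - a)], by linarith⟩).1, hb, add_assoc,
    add_right_inj, ← sub_eq_iff_eq_add', ← sub_smul] at e1
  rw [show b - min ε (b - a) - a - (b - a) = b - min ε (b - a) - b by ring] at e1
  have hne : b - min ε (b - a) - b ≠ 0 := by linarith
  rwa [smul_right_injective (E m) hne e1]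

/-! ### Translations in time and space -/

/-- The trajectory started `a` later, with the lifting translated by `j`. -/
noncomputable def shift (T : Trajectory O) (a : ℝ) (j : Fin m → ℤ) : Trajectory O where
  pos t := T.pos (t + a) + intVec j
  vel t := T.vel (t + a)
  norm_vel t := T.norm_vel _
  outside t k hk := T.outside (t + a) (k - j) (by
    rw [mem_interior_obstacle] at hk ⊢
    rwa [intVec_sub, show T.pos (t + a) - (intVec k - intVec j)
      = T.pos (t + a) + intVec j - intVec k by abel])
  motion t := by
    have e : ∀ k, T.pos (t + a) - intVec (k - j) = T.pos (t + a) + intVec j - intVec k :=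
      fun k => by rw [intVec_sub]; abel
    obtain ⟨ε, hε, w, h1, h2, h3, h4⟩ := T.motion (t + a)
    refine ⟨ε, hε, w, fun s hs => ?_, fun s hs => ?_, fun h => h3 fun k hk => h (k + j) ?_,
      fun k n hk hn => h4 (k - j) n ?_ ?_⟩
    · rw [h1 (s + a) ⟨by linarith [hs.1], by linarith [hs.2]⟩]; module
    · rw [h2 (s + a) ⟨by linarith [hs.1], by linarith [hs.2]⟩]; module
    · rw [mem_frontier_obstacle] at hk ⊢
      rwa [← e, add_sub_cancel_right]
    · rw [mem_frontier_obstacle] at hk ⊢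
      rwa [e]
    · rw [isOuterNormal_obstacle] at hn ⊢
      rwa [e]

theorem reflectsAt_shift {T : Trajectory O} {a t : ℝ} {j k : Fin m → ℤ} :
    (T.shift a j).ReflectsAt t k ↔ T.ReflectsAt (t + a) (k - j) := by
  have e : T.pos (t + a) - intVec (k - j) = T.pos (t + a) + intVec j - intVec k := by
    rw [intVec_sub]; abel
  simp only [ReflectsAt, shift, mem_frontier_obstacle, isOuterNormal_obstacle, e]

theorem HasAdmissibleType.shift {T : Trajectory O} (h : T.HasAdmissibleType) (a : ℝ)
    (j : Fin m → ℤ) : (T.shift a j).HasAdmissibleType := by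
  obtain ⟨i, k, hk, t, ht, h1, h2⟩ := h
  refine ⟨j + i, k, hk, fun n => t n - a, fun x y hxy => sub_lt_sub_right (ht hxy) a,
    fun n => ?_, fun b l hb => ?_⟩
  · rw [reflectsAt_shift, sub_add_cancel]
    simpa only [add_assoc, add_sub_cancel_left] using h1 n
  · obtain ⟨n, hn⟩ := h2 _ _ (reflectsAt_shift.1 hb)
    exact ⟨n, eq_sub_of_add_eq hn⟩

theorem phase_shift {T : Trajectory O} {a : ℝ} {j : Fin m → ℤ} (t : ℝ) :
    (T.shift a j).phase t = T.phase (t + a) := by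
  unfold phase
  congr 1
  refine Subtype.ext (Prod.ext ?_ rfl)
  exact proj_eq_iff.2 ⟨j, rfl⟩

end Trajectory

/-! ### Phase points determine trajectories -/

theorem Glue.mk_eq {p q : PrePhase O} (h : p = q ∨ Glue O p q) :
    (Quot.mk _ p : PhaseSpace O) = Quot.mk _ q := by
  rcases h with rfl | h
  · rfl
  · exact Quot.sound h

/-- Chains of gluings collapse: by smallness two successive gluings happen at the same boundary
point, by smoothness with the same normal, so the second undoes the first. -/
theorem eq_or_glue_of_mk_eq (hO : IsObstacle O) (hs : IsSmall O) {p q : PrePhase O}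
    (h : (Quot.mk _ p : PhaseSpace O) = Quot.mk _ q) : p = q ∨ Glue O p q := by
  replace h := Quot.eqvGen_exact h
  have hsymm : ∀ {p q}, Glue O p q → Glue O q p := by
    rintro p q ⟨x, n, hx, hn, h1, h2, h3⟩
    exact ⟨x, n, hx, hn, h2, h1, by rw [h3, reflect_reflect hn.1]⟩
  induction h with
  | rel p q h => exact Or.inr h
  | refl p => exact Or.inl rfl
  | symm p q _ ih => exact ih.imp Eq.symm hsymm
  | trans p q r _ _ ih1 ih2 =>
    rcases ih1 with rfl | g1
    · exact ih2
    rcases ih2 with rfl | g2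
    · exact Or.inr g1
    left
    obtain ⟨x, n, hx, hn, h1, h2, h3⟩ := g1
    obtain ⟨x', n', hx', hn', h1', h2', h3'⟩ := g2
    obtain ⟨k, rfl⟩ := proj_eq_iff.1 (h2.symm.trans h1')
    have hc := hO.isClosed.frontier_subset
    have hk : k = 0 := hs.eq_of_mem (x := x' + intVec k) (add_mem_obstacle (hc hx'))
      (by simpa [mem_obstacle] using hc hx)
    subst hk
    rw [intVec_zero, add_zero] at *
    obtain ⟨n₀, -, hu, -⟩ := exists_outerNormal_of_mem_frontier hO hx
    obtain rfl := hu n hn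
    obtain rfl := hu n' hn'
    refine Subtype.ext (Prod.ext (h1.trans h2'.symm) ?_)
    rw [h3', h3, reflect_reflect hn.1]

/-- If the phase points are merely glued, both velocities point outwards while their normal
components are opposite; both are therefore tangential and the velocities coincide. -/
theorem Trajectory.eq_shift_of_phase_eq (hO : IsObstacle O) (hs : IsSmall O)
    {T T' : Trajectory O} {b : ℝ} (h : T.phase 0 = T'.phase b) : ∃ j, T = T'.shift b j := by
  have hpv : proj (T.pos 0) = proj (T'.pos b) ∧ T.vel 0 = T'.vel b := by
    rcases eq_or_glue_of_mk_eq hO hs h with h | ⟨x, n, hx, hn, h1, h2, h3⟩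
    · exact ⟨congrArg (fun p => p.1.1) h, congrArg (fun p => p.1.2) h⟩
    · replace h1 : proj (T.pos 0) = proj x := h1
      replace h2 : proj (T'.pos b) = proj x := h2
      replace h3 : T'.vel b = reflect n (T.vel 0) := h3
      refine ⟨h1.trans h2.symm, ?_⟩
      have key : ∀ (S : Trajectory O) (a : ℝ), proj (S.pos a) = proj x →
          0 ≤ inner ℝ (S.vel a) n := fun S a ha => by
        obtain ⟨k, hk⟩ := proj_eq_iff.1 ha
        have e : S.pos a - intVec k = x := by rw [hk]; abel
        exact S.inner_vel_nonneg hO (k := k) (mem_frontier_obstacle.2 (by rwa [e]))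
          (isOuterNormal_obstacle.2 (by rwa [e]))
      have k1 := key T 0 h1
      have k2 := key T' b h2
      rw [h3, inner_reflect hn.1] at k2
      rw [h3, reflect_eq_self (by linarith)]
  obtain ⟨j, hj⟩ := proj_eq_iff.1 hpv.1
  refine ⟨j, ?_⟩
  have := Trajectory.eq_of_eq_at hO (T := T) (T' := T'.shift b j) (a := 0)
    (by simpa [Trajectory.shift] using hj) (by simpa [Trajectory.shift] using hpv.2)
  cases T
  simp only [Trajectory.shift, Trajectory.mk.injEq] at this ⊢
  exact ⟨funext fun t => (this t).1, funext fun t => (this t).2⟩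

/-! ### Words of steps and lengths of paths -/

/-- The obstacle reached after `i` steps of the word `P`. -/
def vertex (P : List (Fin m → ℤ)) (i : ℕ) : Fin m → ℤ := (P.take i).sum

@[simp] theorem vertex_zero (P : List (Fin m → ℤ)) : vertex P 0 = 0 := by simp [vertex]

theorem vertex_length (P : List (Fin m → ℤ)) : vertex P P.length = P.sum := by simp [vertex]

theorem vertex_append_of_le {P Q : List (Fin m → ℤ)} {i : ℕ} (h : i ≤ P.length) :
    vertex (P ++ Q) i = vertex P i := by
  rw [vertex, vertex, List.take_append_of_le_length h]

theorem vertex_append_add (P Q : List (Fin m → ℤ)) (i : ℕ) :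
    vertex (P ++ Q) (P.length + i) = P.sum + vertex Q i := by
  simp [vertex, List.take_length_add_append]

/-- The length of the broken line with vertices `y 0, …, y s`. -/
noncomputable def pathLen (y : ℕ → E m) (s : ℕ) : ℝ := ∑ i ∈ Finset.range s, ‖y (i + 1) - y i‖

theorem pathLen_nonneg (y : ℕ → E m) (s : ℕ) : 0 ≤ pathLen y s :=
  Finset.sum_nonneg fun _ _ => norm_nonneg _

theorem pathLen_add (y : ℕ → E m) (s t : ℕ) :
    pathLen y (s + t) = pathLen y s + pathLen (fun i => y (s + i)) t :=
  Finset.sum_range_add _ _ _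

theorem pathLen_succ (y : ℕ → E m) (s : ℕ) : pathLen y (s + 1) = pathLen y s + ‖y (s + 1) - y s‖ :=
  Finset.sum_range_succ _ _

/-- The broken line visits the obstacles prescribed by the word `P`. -/
def IsPath (O : Set (E m)) (P : List (Fin m → ℤ)) (y : ℕ → E m) : Prop :=
  ∀ i ≤ P.length, y i ∈ obstacle O (vertex P i)

/-- The length of the shortest path visiting the obstacles prescribed by the word `P`. -/
noncomputable def wordLen (O : Set (E m)) (P : List (Fin m → ℤ)) : ℝ :=
  sInf {l | ∃ y, IsPath O P y ∧ pathLen y P.length = l}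

theorem IsPath.wordLen_le {P : List (Fin m → ℤ)} {y : ℕ → E m} (h : IsPath O P y) :
    wordLen O P ≤ pathLen y P.length :=
  csInf_le ⟨0, by rintro _ ⟨y, -, rfl⟩; exact pathLen_nonneg _ _⟩ ⟨y, h, rfl⟩

theorem le_wordLen (hO : O.Nonempty) {P : List (Fin m → ℤ)} {c : ℝ}
    (h : ∀ y, IsPath O P y → c ≤ pathLen y P.length) : c ≤ wordLen O P := by
  obtain ⟨o, ho⟩ := hO
  refine le_csInf ⟨_, fun i => o + intVec (vertex P i), fun i _ => add_mem_obstacle ho, rfl⟩ ?_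
  rintro _ ⟨y, hy, rfl⟩
  exact h y hy

theorem wordLen_nonneg (hO : O.Nonempty) (P : List (Fin m → ℤ)) : 0 ≤ wordLen O P :=
  le_wordLen hO fun _ _ => pathLen_nonneg _ _

theorem wordLen_nil (hO : O.Nonempty) : wordLen O ([] : List (Fin m → ℤ)) = 0 := by
  refine le_antisymm ?_ (wordLen_nonneg hO _)
  obtain ⟨o, ho⟩ := hO
  have : IsPath O ([] : List (Fin m → ℤ)) fun _ => o := fun i _ => by
    simpa [vertex, mem_obstacle] using ho
  simpa [pathLen] using this.wordLen_le

theorem wordLen_singleton_le (hO : O.Nonempty) (d : Fin m → ℤ) :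
    wordLen O [d] ≤ ‖intVec d‖ := by
  obtain ⟨o, ho⟩ := hO
  have : IsPath O [d] fun i => o + intVec (vertex [d] i) := fun i _ => add_mem_obstacle ho
  simpa [pathLen, vertex] using this.wordLen_le

/-- A path for the concatenation is cut at the common obstacle, and its second half is translated
back. -/
theorem wordLen_add_le (hO : O.Nonempty) (P Q : List (Fin m → ℤ)) :
    wordLen O P + wordLen O Q ≤ wordLen O (P ++ Q) := by
  refine le_wordLen hO fun y hy => ?_
  have h1 : IsPath O P y := fun i hi => by
    rw [← vertex_append_of_le (Q := Q) hi]
    exact hy i (by rw [List.length_append]; omega)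
  have h2 : IsPath O Q fun i => y (P.length + i) - intVec P.sum := fun i hi => by
    have := hy (P.length + i) (by rw [List.length_append]; omega)
    rw [vertex_append_add] at this
    rw [← obstacle_add (j := P.sum)]
    simpa using this
  have h3 : pathLen (fun i => y (P.length + i) - intVec P.sum) Q.length
      = pathLen (fun i => y (P.length + i)) Q.length := by
    simp [pathLen]
  rw [List.length_append, pathLen_add, ← h3]
  exact add_le_add h1.wordLen_le h2.wordLen_le

/-- Near-optimal paths for the two words may meet the common obstacle at different points; bridging
them costs less than its diameter, hence the 1. -/
theorem wordLen_append_le (hO : O.Nonempty) (hs : IsSmall O) (P Q : List (Fin m → ℤ)) :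
    wordLen O (P ++ Q) ≤ wordLen O P + wordLen O Q + 1 := by
  have key : ∀ y, IsPath O P y → ∀ y', IsPath O Q y' →
      wordLen O (P ++ Q) ≤ pathLen y P.length + pathLen y' Q.length + 1 := fun y hy y' hy' => by
    -- The junction is the last vertex of `y`; the starting point `y' 0` is dropped, so only the
    -- first edge of the second half changes.
    let z : ℕ → E m := fun i => if i ≤ P.length then y i else y' (i - P.length) + intVec P.sum
    have hz1 : ∀ i ≤ P.length, z i = y i := fun i hi => if_pos hi
    have hz2 : ∀ i, z (P.length + (i + 1)) = y' (i + 1) + intVec P.sum := fun i => by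
      simp only [z]
      rw [if_neg (by omega), show P.length + (i + 1) - P.length = i + 1 by omega]
    have hz : IsPath O (P ++ Q) z := fun i hi => by
      rw [List.length_append] at hi
      rcases le_or_gt i P.length with h | h
      · rw [hz1 i h, vertex_append_of_le h]; exact hy i h
      · obtain ⟨j, rfl⟩ : ∃ j, i = P.length + (j + 1) := ⟨i - P.length - 1, by omega⟩
        rw [hz2, vertex_append_add, obstacle_add]
        exact hy' _ (by omega)
    refine hz.wordLen_le.trans ?_
    rw [List.length_append, pathLen_add, add_assoc]
    refine add_le_add (Finset.sum_le_sum fun i hi => ?_) ?_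
    · rw [Finset.mem_range] at hi
      rw [hz1 i hi.le, hz1 (i + 1) hi]
    · calc pathLen (fun i => z (P.length + i)) Q.length
          ≤ ∑ i ∈ Finset.range Q.length, (‖y' (i + 1) - y' i‖ + if i = 0 then 1 else 0) := by
            refine Finset.sum_le_sum fun i hi => ?_
            rcases i with _ | i
            · have h1 : ‖y' 0 + intVec P.sum - y P.length‖ ≤ 1 := by
                have a1 := hy P.length le_rfl
                rw [vertex_length, mem_obstacle] at a1
                have a2 := hy' 0 (Nat.zero_le _)
                rw [vertex_zero, mem_obstacle, intVec_zero, sub_zero] at a2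
                have := hs.norm_sub_lt a2 a1
                rw [show y' 0 - (y P.length - intVec P.sum)
                  = y' 0 + intVec P.sum - y P.length by abel] at this
                linarith
              beta_reduce
              rw [hz2, add_zero, hz1 _ le_rfl, if_pos rfl]
              calc ‖y' (0 + 1) + intVec P.sum - y P.length‖
                  = ‖(y' (0 + 1) - y' 0) + (y' 0 + intVec P.sum - y P.length)‖ := by
                    congr 1; abel
                _ ≤ _ := (norm_add_le _ _).trans (by linarith)
            · beta_reduce
              rw [hz2, hz2, if_neg (Nat.succ_ne_zero i), add_zero, add_sub_add_right_eq_sub]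
        _ ≤ pathLen y' Q.length + 1 := by
            rw [Finset.sum_add_distrib, Finset.sum_ite_eq']
            refine add_le_add le_rfl ?_
            split_ifs <;> norm_num
  have h1 : ∀ y', IsPath O Q y' →
      wordLen O (P ++ Q) - pathLen y' Q.length - 1 ≤ wordLen O P := fun y' hy' =>
    le_wordLen hO fun y hy => by linarith [key y hy y' hy']
  have h2 : wordLen O (P ++ Q) - wordLen O P - 1 ≤ wordLen O Q :=
    le_wordLen hO fun y' hy' => by linarith [h1 y' hy']
  linarith

/-! ### Deviation of words from uniform motion -/

/-- The deviation of the displacement along a word from the displacement of a point moving with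
velocity `u`. -/
noncomputable def wordErr (O : Set (E m)) (u : E m) (P : List (Fin m → ℤ)) : E m :=
  intVec P.sum - wordLen O P • u

/-- The displacement is exactly additive, and the length is additive up to 1. -/
theorem norm_wordErr_append_sub_le (hO : O.Nonempty) (hs : IsSmall O) (u : E m)
    (P Q : List (Fin m → ℤ)) :
    ‖wordErr O u (P ++ Q) - wordErr O u P - wordErr O u Q‖ ≤ ‖u‖ := by
  have h1 := wordLen_add_le hO P Q
  have h2 := wordLen_append_le hO hs P Q
  have e : wordErr O u (P ++ Q) - wordErr O u P - wordErr O u Q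
      = -((wordLen O (P ++ Q) - wordLen O P - wordLen O Q) • u) := by
    simp only [wordErr, List.sum_append, intVec_add]
    module
  rw [e, norm_neg, norm_smul, Real.norm_eq_abs, abs_of_nonneg (by linarith)]
  nlinarith [norm_nonneg u]

theorem norm_wordErr_append_le (hO : O.Nonempty) (hs : IsSmall O) (u : E m)
    (P Q : List (Fin m → ℤ)) :
    ‖wordErr O u (P ++ Q)‖ ≤ ‖wordErr O u P‖ + ‖wordErr O u Q‖ + ‖u‖ := by
  have h := norm_wordErr_append_sub_le hO hs u P Q
  have h1 := norm_sub_norm_le (wordErr O u (P ++ Q)) (wordErr O u P + wordErr O u Q)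
  rw [← sub_sub] at h1
  linarith [norm_add_le (wordErr O u P) (wordErr O u Q)]

theorem norm_wordErr_le (hO : O.Nonempty) (hs : IsSmall O) (u : E m) {R : ℝ}
    (hR : ∀ d, IsStep O d → ‖intVec d‖ ≤ R) {P : List (Fin m → ℤ)} (hP : ∀ d ∈ P, IsStep O d) :
    ‖wordErr O u P‖ ≤ P.length * (R + R * ‖u‖ + ‖u‖) := by
  induction P with
  | nil => simp [wordErr, wordLen_nil hO]
  | cons d P ih =>
    have h1 := norm_wordErr_append_le hO hs u [d] P
    have h2 := ih fun e he => hP e (List.mem_cons_of_mem _ he)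
    have hd := hR d (hP d List.mem_cons_self)
    have h3 : ‖wordErr O u [d]‖ ≤ R + R * ‖u‖ := by
      refine (norm_sub_le _ _).trans (add_le_add (by simpa using hd) ?_)
      rw [norm_smul, Real.norm_eq_abs, abs_of_nonneg (wordLen_nonneg hO _)]
      exact mul_le_mul_of_nonneg_right ((wordLen_singleton_le hO d).trans hd) (norm_nonneg u)
    rw [List.singleton_append] at h1
    push_cast [List.length_cons]
    linarith

/-! ### Broken lines satisfying the reflection law are almost shortest -/

/-- Each edge of a competitor is at least as long as its projection to `v i`. Summation by parts
leaves interior terms whose sign is given by `hcrit` and two end terms, each at most the diameter of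
an obstacle. -/
theorem sum_le_pathLen_of_critical (hs : IsSmall O) {s : ℕ} {k : ℕ → Fin m → ℤ}
    {x v : ℕ → E m} {l : ℕ → ℝ} (hx : ∀ i ≤ s, x i ∈ obstacle O (k i))
    (hv : ∀ i < s, ‖v i‖ = 1) (hstep : ∀ i < s, x (i + 1) = x i + l i • v i)
    (hcrit : ∀ i, i + 1 < s → ∀ y ∈ obstacle O (k (i + 1)),
      inner ℝ (v (i + 1) - v i) (y - x (i + 1)) ≤ 0)
    {y : ℕ → E m} (hy : ∀ i ≤ s, y i ∈ obstacle O (k i)) :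
    ∑ i ∈ Finset.range s, l i ≤ pathLen y s + 2 := by
  have hstep' : ∀ i < s, l i ≤ ‖y (i + 1) - y i‖
      - inner ℝ (v i) (y (i + 1) - x (i + 1)) + inner ℝ (v i) (y i - x i) := fun i hi => by
    have h1 := real_inner_le_norm (v i) (y (i + 1) - y i)
    rw [hv i hi, one_mul] at h1
    have h2 : inner ℝ (v i) (y (i + 1) - x (i + 1))
        = inner ℝ (v i) (y (i + 1) - y i) + inner ℝ (v i) (y i - x i) - l i := by
      rw [hstep i hi, ← inner_add_right,
        show y (i + 1) - (x i + l i • v i) = (y (i + 1) - y i + (y i - x i)) - l i • v i by abel,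
        inner_sub_right, real_inner_smul_right, real_inner_self_eq_norm_sq, hv i hi]
      ring
    linarith
  have key : ∀ n, n + 1 ≤ s → ∑ i ∈ Finset.range (n + 1), l i ≤ pathLen y (n + 1)
      - inner ℝ (v n) (y (n + 1) - x (n + 1)) + inner ℝ (v 0) (y 0 - x 0) := by
    intro n
    induction n with
    | zero => intro h; simpa [pathLen] using hstep' 0 h
    | succ n ih =>
      intro h
      have h1 := ih (by omega)
      have h2 := hstep' (n + 1) (by omega)
      have h3 := hcrit n (by omega) _ (hy (n + 1) (by omega))
      rw [inner_sub_left] at h3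
      rw [Finset.sum_range_succ _ (n + 1), pathLen_succ]
      linarith
  have hdist : ∀ i ≤ s, ‖y i - x i‖ ≤ 1 := fun i hi => by
    have := hs.dist_obstacle (hx i hi) (hy i hi)
    rw [sub_self, intVec_zero, sub_zero] at this
    linarith
  rcases s with _ | s
  · simp [pathLen]
  · have h1 := key s le_rfl
    have h2 := (abs_le.1 (abs_real_inner_le_norm (v s) (y (s + 1) - x (s + 1)))).1
    have h3 := real_inner_le_norm (v 0) (y 0 - x 0)
    rw [hv _ (by omega), one_mul] at h2 h3
    linarith [hdist 0 (by omega), hdist (s + 1) le_rfl]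

/-! ### Words of trajectory pieces -/

/-- Translation invariance of betweenness turns the conditions on obstacles into conditions on their
differences. -/
theorem FinAdmissible.exists_word (hO : IsObstacle O) {s : ℕ} {k : ℕ → Fin m → ℤ}
    (h : FinAdmissible O s k) : ∃ P : List (Fin m → ℤ), P.length = s ∧ (∀ d ∈ P, IsStep O d) ∧
      P.IsChain (Follows O) ∧ ∀ i ≤ s, vertex P i = k i := by
  refine ⟨(List.range s).map fun i => k (i + 1) - k i, by simp, ?_, ?_, fun i hi => ?_⟩
  · simp only [List.mem_map, List.mem_range, forall_exists_index, and_imp]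
    rintro _ i hi rfl
    refine ⟨sub_ne_zero.2 (h.ne i hi), fun j hj => h.not_between i hi (k i + j) ?_⟩
    simpa using (between_add hO (k i)).2 hj
  · rw [List.isChain_iff_getElem]
    intro i hi hb
    simp only [List.length_map, List.length_range] at hi
    simp only [List.getElem_map, List.getElem_range] at hb
    apply h.not_between_next i (by omega)
    simpa using (between_add hO (k i)).2 hb
  · rw [vertex, ← List.map_take, List.take_range, min_eq_left hi]
    clear hi
    induction i with
    | zero => simp [h.zero]
    | succ i ih => simp [List.range_succ, ih]

/-- The piece itself competes for `wordLen`, which bounds `wordLen` by its length. Conversely,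
reflections make it critical, so it exceeds no competitor by more than 2. -/
theorem Trajectory.PieceHasType.exists_word (hO : IsObstacle O) (hs : IsSmall O)
    {T : Trajectory O} {τ : ℝ} {s : ℕ} {k : ℕ → Fin m → ℤ} (h : T.PieceHasType τ s k)
    (hk : FinAdmissible O s k) : ∃ P : List (Fin m → ℤ), (∀ d ∈ P, IsStep O d) ∧
      P.IsChain (Follows O) ∧ ‖intVec P.sum - (T.pos τ - T.pos 0)‖ ≤ 1 ∧ |wordLen O P - τ| ≤ 2 := by
  obtain ⟨P, hlen, hst, hch, hver⟩ := hk.exists_word hO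
  obtain ⟨t, ht0, hts, hlt, h0, hrefl, honly⟩ := h
  have hmono : ∀ i j, i ≤ j → j ≤ s → t i ≤ t j := by
    intro i j hij
    induction j, hij using Nat.le_induction with
    | base => exact fun _ => le_rfl
    | succ j _ ih => exact fun hj => (ih (by omega)).trans (hlt j hj).le
  have hfr : ∀ i ≤ s, T.pos (t i) ∈ frontier (obstacle O (k i)) := fun i hi => by
    rcases i with _ | i
    · rw [ht0]; exact h0
    · exact (hrefl (i + 1) (by omega) hi).1
  have hmem : ∀ i ≤ s, T.pos (t i) ∈ obstacle O (k i) := fun i hi =>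
    frontier_obstacle_subset hO _ (hfr i hi)
  have hstr : ∀ i < s, T.pos (t (i + 1)) = T.pos (t i) + (t (i + 1) - t i) • T.vel (t i) ∧
      ReflectionLaw O (T.pos (t (i + 1))) (T.vel (t (i + 1))) (T.vel (t i)) := fun i hi => by
    refine T.straight hO (hlt i hi) fun a ha j hj => ?_
    obtain ⟨l, hl, rfl⟩ := honly a ⟨ht0 ▸ (hmono 0 i (Nat.zero_le _) hi.le).trans_lt ha.1,
      hts ▸ ha.2.trans_le (hmono _ _ hi le_rfl)⟩ j hj
    rcases le_or_gt l i with h | h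
    · exact absurd ha.1 (not_lt.2 (hmono l i h hi.le))
    · exact absurd ha.2 (not_lt.2 (hmono (i + 1) l h hl))
  have htel : ∑ i ∈ Finset.range s, (t (i + 1) - t i) = τ := by
    rw [Finset.sum_range_sub, ht0, hts, sub_zero]
  have hpath : IsPath O P fun i => T.pos (t i) := fun i hi => by
    rw [hlen] at hi
    rw [hver i hi]; exact hmem i hi
  refine ⟨P, hst, hch, ?_, abs_le.2 ⟨?_, ?_⟩⟩
  · have := hs.dist_obstacle (hmem 0 (Nat.zero_le _)) (hmem s le_rfl)
    rw [ht0, hts, hk.zero, sub_zero, ← hver s le_rfl, ← hlen, vertex_length, norm_sub_rev] at this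
    linarith
  · have : τ - 2 ≤ wordLen O P := by
      refine le_wordLen hO.nonempty fun y hy => ?_
      have := sum_le_pathLen_of_critical hs (s := s) (k := k) (x := fun i => T.pos (t i))
        (v := fun i => T.vel (t i)) (l := fun i => t (i + 1) - t i) hmem
        (fun i _ => T.norm_vel _) (fun i hi => (hstr i hi).1) (fun i hi z hz => ?_) (y := y)
        (fun i hi => by rw [← hver i hi]; exact hy i (hlen ▸ hi))
      · rw [htel] at this
        rw [hlen]
        linarith
      -- A reflection adds to the velocity a positive multiple of the outer normal; this is the
      -- required criticality.
      · obtain ⟨hx, n, hn, hpos⟩ := hrefl (i + 1) (by omega) hi.le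
        have e := (hstr i (by omega)).2.2 _ n hx hn
        have e' : T.vel (t (i + 1)) - T.vel (t i) = (2 * inner ℝ (T.vel (t (i + 1))) n) • n := by
          rw [e, inner_reflect hn.1, reflect]; module
        rw [e', real_inner_smul_left]
        exact mul_nonpos_of_nonneg_of_nonpos (by positivity) (hn.2 z hz)
    linarith
  · have h1 := hpath.wordLen_le
    have h2 : pathLen (fun i => T.pos (t i)) P.length = τ := by
      rw [← htel, hlen]
      refine Finset.sum_congr rfl fun i hi => ?_
      rw [Finset.mem_range] at hi
      beta_reduce
      rw [(hstr i hi).1, add_sub_cancel_left, norm_smul, T.norm_vel, mul_one, Real.norm_eq_abs,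
        abs_of_pos (sub_pos.2 (hlt i hi))]
    linarith

/-! ### Words with bounded deviation -/

/-- Interiority puts `u - (δ/2) e` in the rotation set. A long piece with nearly this mean velocity
drifts away from `u` against `e` at a linear rate. -/
theorem exists_word_inner_lt (hO : IsObstacle O) (hs : IsSmall O) {u : E m}
    (hu : u ∈ interior (admissibleRotationSet O)) (M : ℝ) {e : E m} (he : ‖e‖ = 1) :
    ∃ P : List (Fin m → ℤ), (∀ d ∈ P, IsStep O d) ∧ P.IsChain (Follows O) ∧
      inner ℝ (wordErr O u P) e < -M := by
  obtain ⟨δ, hδ, hball⟩ := Metric.mem_nhds_iff.1 (mem_interior_iff_mem_nhds.1 hu)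
  obtain ⟨T, τ, htype, hτ, hlim⟩ := hball (show u - (δ / 2) • e ∈ Metric.ball u δ by
    rw [mem_ball_iff_norm, sub_sub_cancel_left, norm_neg, norm_smul, he, Real.norm_eq_abs,
      abs_of_pos (by positivity)]
    linarith)
  have hlim' := ((hlim.sub_const u).inner (tendsto_const_nhds (x := e)) (𝕜 := ℝ)).eventually_lt_const
    (show _ < -(δ / 4) by
      rw [sub_sub_cancel_left, inner_neg_left, real_inner_smul_left, real_inner_self_eq_norm_sq, he]
      linarith)
  -- The length is chosen so that the drift, at least `τ n * (δ / 4)`, exceeds `|M|` plus the errors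
  -- 1 and `2 * ‖u‖` of passing to words.
  obtain ⟨n, ⟨hn1, hn2⟩, hn3⟩ := ((hlim'.and (hτ.eventually_gt_atTop
    (4 / δ * (|M| + 1 + 2 * ‖u‖)))).and (hτ.eventually_gt_atTop 0)).exists
  obtain ⟨s, k, hk, hp⟩ := htype n
  obtain ⟨P, h1, h2, h3, h4⟩ := hp.exists_word hO hs hk
  refine ⟨P, h1, h2, ?_⟩
  set D := (T n).pos (τ n) - (T n).pos 0
  have e1 : wordErr O u P = (intVec P.sum - D) - (wordLen O P - τ n) • u
      + τ n • ((τ n)⁻¹ • D - u) := by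
    rw [wordErr, smul_sub (τ n), smul_smul, mul_inv_cancel₀ hn3.ne', one_smul]
    module
  have b1 := real_inner_le_norm (intVec P.sum - D) e
  have b2 := real_inner_le_norm (-((wordLen O P - τ n) • u)) e
  rw [norm_neg, norm_smul, Real.norm_eq_abs, he, inner_neg_left] at b2
  rw [he] at b1
  have b3 : |wordLen O P - τ n| * ‖u‖ ≤ 2 * ‖u‖ := mul_le_mul_of_nonneg_right h4 (norm_nonneg u)
  have b4 : τ n * inner ℝ ((τ n)⁻¹ • D - u) e ≤ τ n * -(δ / 4) :=
    mul_le_mul_of_nonneg_left hn1.le hn3.le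
  have b5 : |M| + 1 + 2 * ‖u‖ < τ n * (δ / 4) := by
    calc |M| + 1 + 2 * ‖u‖ = 4 / δ * (|M| + 1 + 2 * ‖u‖) * (δ / 4) := by field_simp
      _ < τ n * (δ / 4) := mul_lt_mul_of_pos_right hn2 (by positivity)
  rw [e1, inner_add_left, inner_sub_left, real_inner_smul_left (r := τ n)]
  linarith [le_abs_self M]

theorem exists_finite_words (hO : IsObstacle O) (hs : IsSmall O) {u : E m}
    (hu : u ∈ interior (admissibleRotationSet O)) (M : ℝ) :
    ∃ F : Finset (List (Fin m → ℤ)),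
      (∀ P ∈ F, (∀ d ∈ P, IsStep O d) ∧ P.IsChain (Follows O)) ∧
      ∀ e : E m, ‖e‖ = 1 → ∃ P ∈ F, inner ℝ (wordErr O u P) e < -M := by
  classical
  have hex : ∀ e : E m, ∃ P : List (Fin m → ℤ), ((∀ d ∈ P, IsStep O d) ∧ P.IsChain (Follows O)) ∧
      (‖e‖ = 1 → inner ℝ (wordErr O u P) e < -M) := fun e => by
    by_cases he : ‖e‖ = 1
    · obtain ⟨P, h1, h2, h3⟩ := exists_word_inner_lt hO hs hu M he
      exact ⟨P, ⟨h1, h2⟩, fun _ => h3⟩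
    · exact ⟨[], ⟨by simp, .nil⟩, fun h => absurd h he⟩
  choose W hW hW' using hex
  obtain ⟨t, ht, hcov⟩ := (isCompact_sphere (0 : E m) 1).elim_nhds_subcover
    (fun e => {e' | inner ℝ (wordErr O u (W e)) e' < -M}) fun e he =>
      (isOpen_lt (by fun_prop) continuous_const).mem_nhds (hW' e (by simpa using he))
  refine ⟨t.image W, fun P hP => ?_, fun e he => ?_⟩
  · obtain ⟨e, -, rfl⟩ := Finset.mem_image.1 hP
    exact hW e
  · obtain ⟨e', he', h⟩ := Set.mem_iUnion₂.1 (hcov (show e ∈ Metric.sphere (0 : E m) 1 by simpa))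
    exact ⟨W e', Finset.mem_image_of_mem W he', h⟩

/-- If `u` is in the interior of the admissible rotation set, then there are arbitrarily long
admissible words whose prefixes all have uniformly bounded deviation. -/
theorem exists_long_word (hm : 2 ≤ m) (hO : IsObstacle O) (hs : IsSmall O) {u : E m}
    (hu : u ∈ interior (admissibleRotationSet O)) :
    ∃ C : ℝ, ∀ n : ℕ, ∃ P : List (Fin m → ℤ), n ≤ P.length ∧ (∀ d ∈ P, IsStep O d) ∧
      P.IsChain (Follows O) ∧ ∀ i, ‖wordErr O u (P.take i)‖ ≤ C := by
  have hne := hO.nonempty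
  obtain ⟨R, hR⟩ := exists_bound_isStep hO
  set K := R + R * ‖u‖ + ‖u‖ with hK
  have hR0 : 0 ≤ R := (norm_nonneg _).trans (hR _ (isStep_single hO hs ⟨0, by omega⟩ (Or.inl rfl)))
  have hu0 := norm_nonneg u
  have hK0 : 0 ≤ K := by positivity
  -- `B` is the cost of appending `W` through two connecting steps: `2 * K` for the steps and `‖u‖`
  -- for each of the two junctions. Asking for `B + 1` below leaves a net gain of 1 per unit of
  -- deviation.
  set B := 2 * K + 2 * ‖u‖ with hB
  have hB0 : 0 ≤ B := by positivity
  obtain ⟨F, hF, hFe⟩ := exists_finite_words hO hs hu (B + 1)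
  obtain ⟨N, hN⟩ : ∃ N : ℕ, ∀ P ∈ F, P.length ≤ N :=
    ⟨F.sup List.length, fun P hP => Finset.le_sup (f := List.length) hP⟩
  -- A bound for the change of deviation caused by one appended block.
  set Z := N * K + B + 1 with hZ
  have hZ1 : 1 ≤ Z := by
    have : (0 : ℝ) ≤ N * K := by positivity
    linarith
  have hcone : ∀ x : E m, ∃ P ∈ F, inner ℝ x (wordErr O u P) ≤ -(B + 1) * ‖x‖ := fun x => by
    rcases eq_or_ne x 0 with rfl | hx
    · obtain ⟨P, hP, -⟩ := hFe (EuclideanSpace.single ⟨0, by omega⟩ 1) (by simp)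
      exact ⟨P, hP, by simp⟩
    · obtain ⟨P, hP, h⟩ := hFe (‖x‖⁻¹ • x) (norm_smul_inv_norm hx)
      refine ⟨P, hP, ?_⟩
      have hx' : 0 < ‖x‖ := norm_pos_iff.2 hx
      rw [real_inner_smul_right, real_inner_comm, inv_mul_eq_div, div_lt_iff₀ hx'] at h
      exact h.le
  refine ⟨Z ^ 2 + Z + (2 + N) * K + ‖u‖, fun n => ?_⟩
  -- The induction needs the sharper bound at block ends; the surplus in the bound for prefixes
  -- covers the inside of one block.
  suffices h : ∃ P : List (Fin m → ℤ), n ≤ P.length ∧ (∀ d ∈ P, IsStep O d) ∧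
      P.IsChain (Follows O) ∧ (∀ i, ‖wordErr O u (P.take i)‖ ≤ Z ^ 2 + Z + (2 + N) * K + ‖u‖) ∧
      ‖wordErr O u P‖ ≤ Z ^ 2 + Z by
    obtain ⟨P, h1, h2, h3, h4, -⟩ := h
    exact ⟨P, h1, h2, h3, h4⟩
  induction n with
  | zero =>
    refine ⟨[], by simp, by simp, .nil, fun i => ?_, ?_⟩ <;>
    · simp only [List.take_nil, wordErr, wordLen_nil hne, List.sum_nil, intVec_zero, zero_smul,
        sub_zero, norm_zero]
      positivity
  | succ n ih =>
    obtain ⟨P, h1, h2, h3, h4, h5⟩ := ih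
    obtain ⟨W, hW, hin⟩ := hcone (wordErr O u P)
    obtain ⟨d, e, hd, he, hch⟩ := exists_connection hm hO hs h3 (hF W hW).2
    have hde : ∀ f ∈ [d, e], IsStep O f := by
      simp only [List.mem_cons, List.not_mem_nil, or_false]
      rintro f (rfl | rfl) <;> assumption
    set Q := [d, e] ++ W with hQ
    have hQs : ∀ f ∈ Q, IsStep O f := fun f hf =>
      (List.mem_append.1 hf).elim (hde f) ((hF W hW).1 f)
    have hQl : (Q.length : ℝ) ≤ 2 + N := by
      have : Q.length ≤ 2 + N := by
        rw [hQ, List.length_append]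
        exact add_le_add le_rfl (hN W hW)
      exact_mod_cast this
    refine ⟨P ++ Q, ?_, fun f hf => (List.mem_append.1 hf).elim (h2 f) (hQs f), hch,
      fun i => ?_, ?_⟩
    · simp only [hQ, List.length_append, List.length_cons]; omega
    · rcases le_or_gt i P.length with hi | hi
      · rw [List.take_append_of_le_length hi]; exact h4 i
      · obtain ⟨j, rfl⟩ := Nat.exists_eq_add_of_le hi.le
        rw [List.take_length_add_append]
        refine (norm_wordErr_append_le hne hs u _ _).trans ?_
        have b1 := norm_wordErr_le hne hs u hR (P := Q.take j)
          fun f hf => hQs f (List.mem_of_mem_take hf)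
        have b2 : ((Q.take j).length : ℝ) ≤ 2 + N := by
          refine le_trans ?_ hQl
          exact_mod_cast List.length_take_le' j Q
        have b3 := mul_le_mul_of_nonneg_right b2 hK0
        linarith
    · set x := wordErr O u P
      set z := wordErr O u (P ++ Q) - x with hz
      have c1 : ‖z - wordErr O u W‖ ≤ B := by
        have a1 := norm_wordErr_append_sub_le hne hs u P Q
        have a2 := norm_wordErr_append_sub_le hne hs u [d, e] W
        have a3 := norm_wordErr_le hne hs u hR hde
        simp only [List.length_cons, List.length_nil] at a3
        push_cast at a3
        calc ‖z - wordErr O u W‖ = ‖(wordErr O u (P ++ Q) - x - wordErr O u Q) +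
              ((wordErr O u Q - wordErr O u [d, e] - wordErr O u W) + wordErr O u [d, e])‖ := by
              congr 1; rw [hz]; abel
          _ ≤ _ + (_ + _) := (norm_add_le _ _).trans (add_le_add le_rfl (norm_add_le _ _))
          _ ≤ B := by linarith
      have c2 : ‖z‖ ≤ Z := by
        have a1 := norm_wordErr_le hne hs u hR (hF W hW).1
        have a2 : (W.length : ℝ) * K ≤ N * K :=
          mul_le_mul_of_nonneg_right (by exact_mod_cast hN W hW) hK0
        have a3 := norm_sub_norm_le z (wordErr O u W)
        linarith
      have c3 : inner ℝ x z ≤ -‖x‖ := by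
        have a1 := real_inner_le_norm x (z - wordErr O u W)
        have a2 := mul_le_mul_of_nonneg_left c1 (norm_nonneg x)
        rw [inner_sub_right] at a1
        linarith
      have e1 : wordErr O u (P ++ Q) = x + z := by rw [hz]; abel
      rw [e1]
      -- Far from the origin, `‖x + z‖² ≤ ‖x‖² - 2‖x‖ + Z² ≤ ‖x‖²`; near it, one block adds at most
      -- `Z`.
      rcases le_or_gt (Z ^ 2) ‖x‖ with hx | hx
      · have a1 := norm_add_sq_real x z
        have a2 : ‖z‖ ^ 2 ≤ Z ^ 2 := pow_le_pow_left₀ (norm_nonneg z) c2 2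
        refine le_trans (le_of_sq_le_sq ?_ (norm_nonneg x)) h5
        nlinarith [norm_nonneg x]
      · exact (norm_add_le x z).trans (by linarith)

/-! ### The reflection law for shortest paths -/

/-- First-order expansion of the norm with a quadratic remainder, from `2‖p‖‖a‖ ≤ ‖p‖² + ‖a‖²`. -/
theorem norm_add_smul_le {p : E m} (hp : p ≠ 0) (z : E m) (r : ℝ) :
    ‖p + r • z‖ ≤ ‖p‖ + r * inner ℝ (‖p‖⁻¹ • p) z + r ^ 2 * (‖z‖ ^ 2 / (2 * ‖p‖)) := by
  have hp' : 0 < ‖p‖ := norm_pos_iff.2 hp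
  have h1 := norm_add_sq_real p (r • z)
  rw [norm_smul, mul_pow, Real.norm_eq_abs, sq_abs, real_inner_smul_right] at h1
  have h2 : ‖p + r • z‖ ≤ (‖p + r • z‖ ^ 2 + ‖p‖ ^ 2) / (2 * ‖p‖) := by
    rw [le_div_iff₀ (by positivity)]
    nlinarith [sq_nonneg (‖p + r • z‖ - ‖p‖)]
  refine h2.trans (le_of_eq ?_)
  rw [h1, real_inner_smul_left]
  field_simp
  ring

/-- The unit vector in the direction from `a` to `b`. -/
noncomputable def direction (a b : E m) : E m := ‖b - a‖⁻¹ • (b - a)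

theorem norm_direction {a b : E m} (h : b ≠ a) : ‖direction a b‖ = 1 :=
  norm_smul_inv_norm (sub_ne_zero.2 h)

theorem norm_smul_direction {a b : E m} (h : b ≠ a) : ‖b - a‖ • direction a b = b - a := by
  rw [direction, smul_smul, mul_inv_cancel₀ (norm_ne_zero_iff.2 (sub_ne_zero.2 h)), one_smul]

/-- First variation: move `x` by `r (y - x)` inside the convex set, divide by `r` and let `r` tend
to 0. -/
theorem inner_direction_sub_nonpos {C : Set (E m)} (hC : Convex ℝ C) {a b x : E m} (hx : x ∈ C)
    (ha : x ≠ a) (hb : b ≠ x) (hmin : ∀ y ∈ C, ‖x - a‖ + ‖b - x‖ ≤ ‖y - a‖ + ‖b - y‖)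
    {y : E m} (hy : y ∈ C) : inner ℝ (direction x b - direction a x) (y - x) ≤ 0 := by
  set z := y - x
  set K := ‖z‖ ^ 2 / (2 * ‖x - a‖) + ‖-z‖ ^ 2 / (2 * ‖b - x‖)
  have key : ∀ r ∈ Set.Ioo (0 : ℝ) 1,
      inner ℝ (direction x b - direction a x) z ≤ r * K := fun r hr => by
    have h1 := hmin _ (hC.add_smul_sub_mem hx hy ⟨hr.1.le, hr.2.le⟩)
    have h2 := norm_add_smul_le (sub_ne_zero.2 ha) z r
    have h3 := norm_add_smul_le (sub_ne_zero.2 hb) (-z) r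
    rw [show x + r • (y - x) - a = x - a + r • z by simp only [z]; abel,
      show b - (x + r • (y - x)) = b - x + r • -z by simp only [z]; rw [smul_neg]; abel] at h1
    rw [inner_neg_right] at h3
    rw [inner_sub_left, direction, direction]
    have h4 : r * (inner ℝ (‖b - x‖⁻¹ • (b - x)) z - inner ℝ (‖x - a‖⁻¹ • (x - a)) z)
        ≤ r * (r * K) := by
      simp only [K]
      linarith
    exact le_of_mul_le_mul_left h4 hr.1
  have hlim : Tendsto (fun r : ℝ => r * K) (𝓝[>] 0) (𝓝 0) := by
    have : Continuous fun r : ℝ => r * K := by fun_prop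
    simpa using (this.tendsto 0).mono_left nhdsWithin_le_nhds
  exact ge_of_tendsto hlim (by
    filter_upwards [Ioo_mem_nhdsGT one_pos] with r hr using key r hr)

theorem mem_segment_of_direction_eq {a b x : E m} (ha : x ≠ a) (hb : b ≠ x)
    (h : direction x b = direction a x) : x ∈ segment ℝ a b := by
  have h1 : 0 < ‖x - a‖ := norm_pos_iff.2 (sub_ne_zero.2 ha)
  have h2 : 0 < ‖b - x‖ := norm_pos_iff.2 (sub_ne_zero.2 hb)
  rw [mem_segment_iff_sameRay]
  exact (sameRay_iff_inv_norm_smul_eq_of_ne (sub_ne_zero.2 ha) (sub_ne_zero.2 hb)).2 h.symm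

/-- The change of direction is nonzero off the segment, and by the first variation it is an outer
normal once normalized. Two unit vectors differing by a multiple of it are mirror images. -/
theorem exists_outerNormal_of_minimal {C : Set (E m)} (hC : Convex ℝ C) {a b x : E m} (hx : x ∈ C)
    (ha : x ≠ a) (hb : b ≠ x) (hmin : ∀ y ∈ C, ‖x - a‖ + ‖b - x‖ ≤ ‖y - a‖ + ‖b - y‖)
    (hseg : x ∉ segment ℝ a b) : ∃ n, IsOuterNormal C x n ∧
      direction x b = reflect n (direction a x) ∧ 0 < inner ℝ (direction x b) n := by
  set w := direction x b - direction a x with hw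
  have hw0 : w ≠ 0 := fun h => hseg (mem_segment_of_direction_eq ha hb (sub_eq_zero.1 h))
  have hwn : 0 < ‖w‖ := norm_pos_iff.2 hw0
  have hn : ‖‖w‖⁻¹ • w‖ = 1 := norm_smul_inv_norm hw0
  have h1 := eq_reflect_of_sub_eq_smul (v := direction x b) (w := direction a x) (c := ‖w‖) hn
    ((norm_direction hb).trans (norm_direction ha).symm) hwn
    (by rw [smul_smul, mul_inv_cancel₀ hwn.ne', one_smul])
  refine ⟨‖w‖⁻¹ • w, ⟨hn, fun y hy => ?_⟩, h1.1, by rw [h1.2]; positivity⟩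
  rw [real_inner_smul_left]
  exact mul_nonpos_of_nonneg_of_nonpos (by positivity)
    (inner_direction_sub_nonpos hC hx ha hb hmin hy)

/-! ### Itineraries -/

/-- The conditions on the obstacles `(q i).1`, the reflection points `(q i).2.1` and the reflection
times `(q i).2.2` of a trajectory that concern the indices `n`, `n + 1` and `n + 2`. -/
structure IsItineraryAt (O : Set (E m)) (q : ℤ → (Fin m → ℤ) × E m × ℝ) (n : ℤ) : Prop where
  step : IsStep O ((q (n + 1)).1 - (q n).1)
  follows : Follows O ((q (n + 1)).1 - (q n).1) ((q (n + 2)).1 - (q (n + 1)).1)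
  mem : (q n).2.1 - intVec (q n).1 ∈ O
  time : (q (n + 1)).2.2 = (q n).2.2 + ‖(q (n + 1)).2.1 - (q n).2.1‖
  minimal : ∀ y ∈ O, ‖(q (n + 1)).2.1 - (q n).2.1‖ + ‖(q (n + 2)).2.1 - (q (n + 1)).2.1‖ ≤
    ‖y + intVec (q (n + 1)).1 - (q n).2.1‖ + ‖(q (n + 2)).2.1 - (y + intVec (q (n + 1)).1)‖

/-- The reflections of a trajectory of admissible type that stays at distance at most `C` from
motions with velocity `u`. -/
structure IsItinerary (O : Set (E m)) (u : E m) (C : ℝ) (q : ℤ → (Fin m → ℤ) × E m × ℝ) :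
    Prop where
  obstacle_zero : (q 0).1 = 0
  time_zero : (q 0).2.2 = 0
  at_index : ∀ n, IsItineraryAt O q n
  deviation : ∀ a b, ‖(q b).2.1 - (q a).2.1 - ((q b).2.2 - (q a).2.2) • u‖ ≤ C

namespace IsItinerary

variable {u : E m} {C : ℝ} {q : ℤ → (Fin m → ℤ) × E m × ℝ}

theorem mem (h : IsItinerary O u C q) (n : ℤ) : (q n).2.1 ∈ obstacle O (q n).1 := (h.at_index n).mem

theorem admissible (hO : IsObstacle O) (h : IsItinerary O u C q) :
    Admissible O fun n => (q n).1 where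
  zero := h.obstacle_zero
  ne n := sub_ne_zero.1 (h.at_index n).step.1
  not_between n j hj := (h.at_index n).step.2 (j - (q n).1)
    ((between_add hO (q n).1).1 (by simpa using hj))
  not_between_next n hj := (h.at_index n).follows ((between_add hO (q n).1).1 (by simpa using hj))

theorem quarter_le (hs : IsSmall O) (h : IsItinerary O u C q) (n : ℤ) :
    1 / 4 ≤ ‖(q (n + 1)).2.1 - (q n).2.1‖ :=
  hs.quarter_le (sub_ne_zero.1 (h.at_index n).step.1) (h.mem n) (h.mem (n + 1))

theorem point_ne (hs : IsSmall O) (h : IsItinerary O u C q) (n : ℤ) :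
    (q (n + 1)).2.1 ≠ (q n).2.1 := by
  intro e
  have := h.quarter_le hs n
  rw [e, sub_self, norm_zero] at this
  norm_num at this

theorem step_eq (hs : IsSmall O) (h : IsItinerary O u C q) (n : ℤ) :
    (q (n + 1)).2.1 = (q n).2.1
      + ((q (n + 1)).2.2 - (q n).2.2) • direction (q n).2.1 (q (n + 1)).2.1 := by
  rw [(h.at_index n).time, add_sub_cancel_left, norm_smul_direction (h.point_ne hs n)]
  abel

/-- `Follows` keeps the middle point off the segment between its neighbours, so every reflection is
genuine. -/
theorem exists_outerNormal (hO : IsObstacle O) (hs : IsSmall O) (h : IsItinerary O u C q) (n : ℤ) :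
    ∃ N, IsOuterNormal (obstacle O (q (n + 1)).1) (q (n + 1)).2.1 N ∧
      direction (q (n + 1)).2.1 (q (n + 2)).2.1
        = reflect N (direction (q n).2.1 (q (n + 1)).2.1) ∧
      0 < inner ℝ (direction (q (n + 1)).2.1 (q (n + 2)).2.1) N := by
  have hne : (q (n + 2)).2.1 ≠ (q (n + 1)).2.1 := by
    simpa [add_assoc] using h.point_ne hs (n + 1)
  refine exists_outerNormal_of_minimal (convex_obstacle hO _) (h.mem _) (h.point_ne hs n) hne
    (fun y hy => ?_) fun hseg => ?_
  · simpa using (h.at_index n).minimal _ (mem_obstacle.1 hy)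
  · have hk : (q (n + 1)).1 ≠ (q (n + 2)).1 := by
      have := (h.admissible hO).ne (n + 1)
      simpa [add_assoc] using this.symm
    exact (h.admissible hO).not_between_next n ⟨(h.admissible hO).ne n, hk, _, h.mem _,
      segment_subset_convexHull (Set.mem_union_left _ (h.mem n))
        (Set.mem_union_right _ (h.mem (n + 2))) hseg⟩

theorem mem_frontier (hO : IsObstacle O) (hs : IsSmall O) (h : IsItinerary O u C q) (n : ℤ) :
    (q n).2.1 ∈ frontier (obstacle O (q n).1) := by
  obtain ⟨N, hN, -⟩ := h.exists_outerNormal hO hs (n - 1)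
  rw [sub_add_cancel] at hN
  exact mem_frontier_of_isOuterNormal (h.mem n) hN

theorem strictMono_time (hs : IsSmall O) (h : IsItinerary O u C q) :
    StrictMono fun n => (q n).2.2 := by
  refine strictMono_int_of_lt_succ fun n => ?_
  have := h.quarter_le hs n
  have := (h.at_index n).time
  linarith

/-- Consecutive obstacles are 1/4 apart, so times minus `n / 4` are monotone: reflection times are
unbounded both ways and do not accumulate. -/
theorem exists_index (hs : IsSmall O) (h : IsItinerary O u C q) (τ : ℝ) :
    ∃ n, (q n).2.2 ≤ τ ∧ τ < (q (n + 1)).2.2 := by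
  have hm : Monotone fun n : ℤ => (q n).2.2 - n / 4 := monotone_int_of_le_succ fun n => by
    have := h.quarter_le hs n
    have := (h.at_index n).time
    push_cast
    linarith
  have h0 := h.time_zero
  have hc := Int.le_ceil (4 * |τ|)
  have hc0 : 0 ≤ ⌈4 * |τ|⌉ := Int.ceil_nonneg (by positivity)
  have hbdd : ∀ z : ℤ, (q z).2.2 ≤ τ → z ≤ ⌈4 * |τ|⌉ := fun z hz => by
    by_contra! hlt
    have h1 := hm (show (0 : ℤ) ≤ z by omega)
    have h2 : (⌈4 * |τ|⌉ : ℝ) < z := by exact_mod_cast hlt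
    simp only [h0, Int.cast_zero, zero_div, sub_zero] at h1
    linarith [le_abs_self τ]
  have hinh : (q (-⌈4 * |τ|⌉)).2.2 ≤ τ := by
    have h1 := hm (show -⌈4 * |τ|⌉ ≤ 0 by omega)
    simp only [h0, Int.cast_neg, Int.cast_zero, zero_div, sub_zero] at h1
    linarith [neg_abs_le τ]
  obtain ⟨n, hn, hmax⟩ := Int.exists_greatest_of_bdd (P := fun n => (q n).2.2 ≤ τ)
    ⟨_, hbdd⟩ ⟨_, hinh⟩
  exact ⟨n, hn, not_le.1 fun hle => by have := hmax _ hle; omega⟩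

theorem index_unique (hs : IsSmall O) (h : IsItinerary O u C q) {τ : ℝ} {a b : ℤ}
    (ha : (q a).2.2 ≤ τ ∧ τ < (q (a + 1)).2.2) (hb : (q b).2.2 ≤ τ ∧ τ < (q (b + 1)).2.2) :
    a = b := by
  have h1 := (h.strictMono_time hs).lt_iff_lt.1 (ha.1.trans_lt hb.2)
  have h2 := (h.strictMono_time hs).lt_iff_lt.1 (hb.1.trans_lt ha.2)
  omega

theorem eq_or_eq_of_mem_obstacle (hO : IsObstacle O) (h : IsItinerary O u C q)
    {n : ℤ} {j : Fin m → ℤ} {p : E m} (hp : p ∈ segment ℝ (q n).2.1 (q (n + 1)).2.1)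
    (hj : p ∈ obstacle O j) : j = (q n).1 ∨ j = (q (n + 1)).1 := by
  by_contra! hne
  exact (h.admissible hO).not_between n j ⟨hne.1, hne.2, p, hj,
    segment_subset_convexHull (Set.mem_union_left _ (h.mem n))
      (Set.mem_union_right _ (h.mem (n + 1))) hp⟩

/-- Admissibility leaves only the two end obstacles, and these lie behind their supporting
hyperplanes, which the segment leaves and approaches transversally. -/
theorem notMem_obstacle (hO : IsObstacle O) (hs : IsSmall O) (h : IsItinerary O u C q)
    {n : ℤ} {τ : ℝ} (hτ : τ ∈ Set.Ioo (q n).2.2 (q (n + 1)).2.2) (j : Fin m → ℤ) :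
    (q n).2.1 + (τ - (q n).2.2) • direction (q n).2.1 (q (n + 1)).2.1 ∉ obstacle O j := by
  intro hj
  have hstep := h.step_eq hs n
  set p := (q n).2.1 + (τ - (q n).2.2) • direction (q n).2.1 (q (n + 1)).2.1 with hp
  have hT : 0 < (q (n + 1)).2.2 - (q n).2.2 := by linarith [hτ.1, hτ.2]
  have hseg : p ∈ segment ℝ (q n).2.1 (q (n + 1)).2.1 := by
    rw [segment_eq_image']
    refine ⟨(τ - (q n).2.2) / ((q (n + 1)).2.2 - (q n).2.2),
      ⟨div_nonneg (by linarith [hτ.1]) hT.le, (div_le_one hT).2 (by linarith [hτ.2])⟩, ?_⟩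
    have e : (q (n + 1)).2.1 - (q n).2.1
        = ((q (n + 1)).2.2 - (q n).2.2) • direction (q n).2.1 (q (n + 1)).2.1 := by
      rw [sub_eq_iff_eq_add']; exact hstep
    simp only [e, smul_smul, div_mul_cancel₀ _ hT.ne', hp]
  rcases h.eq_or_eq_of_mem_obstacle hO hseg hj with rfl | rfl
  · obtain ⟨N, hN, -, hpos⟩ := h.exists_outerNormal hO hs (n - 1)
    rw [sub_add_cancel, show n - 1 + 2 = n + 1 by ring] at hpos
    rw [sub_add_cancel] at hN
    have := hN.2 p hj
    rw [hp, add_sub_cancel_left, real_inner_smul_right, real_inner_comm] at this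
    nlinarith [hτ.1]
  · obtain ⟨N, hN, hrefl, hpos⟩ := h.exists_outerNormal hO hs n
    have := hN.2 p hj
    rw [hrefl, inner_reflect hN.1] at hpos
    have e : p - (q (n + 1)).2.1
        = (τ - (q (n + 1)).2.2) • direction (q n).2.1 (q (n + 1)).2.1 := by
      nth_rw 1 [hstep]
      rw [hp]
      module
    rw [e, real_inner_smul_right, real_inner_comm] at this
    nlinarith [hτ.2]

/-! ### The trajectory with a given itinerary -/

/-- The index of the last reflection up to the time `τ`. -/
noncomputable def index (hs : IsSmall O) (h : IsItinerary O u C q) (τ : ℝ) : ℤ :=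
  (h.exists_index hs τ).choose

theorem index_spec (hs : IsSmall O) (h : IsItinerary O u C q) (τ : ℝ) :
    (q (h.index hs τ)).2.2 ≤ τ ∧ τ < (q (h.index hs τ + 1)).2.2 :=
  (h.exists_index hs τ).choose_spec

theorem index_eq (hs : IsSmall O) (h : IsItinerary O u C q) {τ : ℝ} {n : ℤ}
    (hn : τ ∈ Set.Ico (q n).2.2 (q (n + 1)).2.2) : h.index hs τ = n :=
  h.index_unique hs (h.index_spec hs τ) hn

/-- The position at the time `τ`. -/
noncomputable def pos (hs : IsSmall O) (h : IsItinerary O u C q) (τ : ℝ) : E m :=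
  (q (h.index hs τ)).2.1 + (τ - (q (h.index hs τ)).2.2) •
    direction (q (h.index hs τ)).2.1 (q (h.index hs τ + 1)).2.1

theorem pos_eq (hs : IsSmall O) (h : IsItinerary O u C q) {τ : ℝ} {n : ℤ}
    (hn : τ ∈ Set.Icc (q n).2.2 (q (n + 1)).2.2) :
    h.pos hs τ = (q n).2.1 + (τ - (q n).2.2) • direction (q n).2.1 (q (n + 1)).2.1 := by
  rcases hn.2.lt_or_eq with hlt | rfl
  · rw [pos, h.index_eq hs ⟨hn.1, hlt⟩]
  · rw [pos, h.index_eq hs ⟨le_rfl, h.strictMono_time hs (by omega : n + 1 < n + 1 + 1)⟩, sub_self,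
      zero_smul, add_zero]
    exact h.step_eq hs n

theorem pos_time (hs : IsSmall O) (h : IsItinerary O u C q) (n : ℤ) :
    h.pos hs (q n).2.2 = (q n).2.1 := by
  rw [h.pos_eq hs (n := n) ⟨le_rfl, (h.strictMono_time hs (by omega : n < n + 1)).le⟩]
  simp

theorem eq_time_of_mem_obstacle (hO : IsObstacle O) (hs : IsSmall O) (h : IsItinerary O u C q)
    {τ : ℝ} {j : Fin m → ℤ} (hj : h.pos hs τ ∈ obstacle O j) : ∃ n, τ = (q n).2.2 ∧ j = (q n).1 := by
  obtain ⟨n, hn⟩ := h.exists_index hs τ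
  rcases hn.1.lt_or_eq with hlt | rfl
  · rw [h.pos_eq hs ⟨hn.1, hn.2.le⟩] at hj
    exact absurd hj (h.notMem_obstacle hO hs ⟨hlt, hn.2⟩ j)
  · rw [h.pos_time hs] at hj
    exact ⟨n, rfl, hs.eq_of_mem hj (h.mem n)⟩

/-- The trajectory with the given itinerary. -/
noncomputable def trajectory (hO : IsObstacle O) (hs : IsSmall O) (h : IsItinerary O u C q) :
    Trajectory O where
  pos := h.pos hs
  vel τ := direction (q (h.index hs τ)).2.1 (q (h.index hs τ + 1)).2.1
  norm_vel τ := norm_direction (h.point_ne hs _)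
  outside τ j hj := by
    obtain ⟨n, rfl, rfl⟩ := h.eq_time_of_mem_obstacle hO hs (interior_subset hj)
    rw [h.pos_time hs] at hj
    exact (h.mem_frontier hO hs n).2 hj
  motion τ := by
    obtain ⟨n, hn⟩ := h.exists_index hs τ
    rw [h.index_eq hs hn]
    rcases hn.1.lt_or_eq with hlt | rfl
    · refine ⟨min (τ - (q n).2.2) ((q (n + 1)).2.2 - τ),
        lt_min (sub_pos.2 hlt) (sub_pos.2 hn.2),
        direction (q n).2.1 (q (n + 1)).2.1, fun s hs' => ?_, fun s hs' => ?_, fun _ => rfl,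
        fun k N hk _ => ?_⟩
      · rw [h.pos_eq hs ⟨hn.1, hn.2.le⟩, h.pos_eq hs (n := n) ⟨by linarith [hs'.1], by
          linarith [hs'.2, min_le_right (τ - (q n).2.2) ((q (n + 1)).2.2 - τ)]⟩]
        module
      · rw [h.pos_eq hs ⟨hn.1, hn.2.le⟩, h.pos_eq hs (n := n) ⟨by
          linarith [hs'.1, min_le_left (τ - (q n).2.2) ((q (n + 1)).2.2 - τ)], by
          linarith [hs'.2]⟩]
        module
      · rw [h.pos_eq hs ⟨hn.1, hn.2.le⟩] at hk
        exact absurd (frontier_obstacle_subset hO k hk) (h.notMem_obstacle hO hs ⟨hlt, hn.2⟩ k)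
    · obtain ⟨p, rfl⟩ : ∃ p, n = p + 1 := ⟨n - 1, by ring⟩
      have hp := h.strictMono_time hs (by omega : p < p + 1)
      dsimp only at hp
      have e2 : p + 1 + 1 = p + 2 := by ring
      refine ⟨min ((q (p + 1)).2.2 - (q p).2.2) ((q (p + 1 + 1)).2.2 - (q (p + 1)).2.2),
        lt_min (sub_pos.2 hp) (sub_pos.2 hn.2),
        direction (q p).2.1 (q (p + 1)).2.1, fun s hs' => ?_, fun s hs' => ?_, fun hk => ?_,
        fun k N hk hN => ?_⟩
      · rw [h.pos_time hs, h.pos_eq hs (n := p + 1) ⟨by linarith [hs'.1], by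
          linarith [hs'.2, min_le_right ((q (p + 1)).2.2 - (q p).2.2)
            ((q (p + 1 + 1)).2.2 - (q (p + 1)).2.2)]⟩]
      · rw [h.pos_time hs, h.pos_eq hs (n := p) ⟨by
          linarith [hs'.1, min_le_left ((q (p + 1)).2.2 - (q p).2.2)
            ((q (p + 1 + 1)).2.2 - (q (p + 1)).2.2)], by linarith [hs'.2]⟩]
        nth_rw 2 [h.step_eq hs p]
        module
      · rw [h.pos_time hs] at hk
        exact absurd (h.mem_frontier hO hs (p + 1)) (hk _)
      · rw [h.pos_time hs] at hk hN
        obtain rfl := hs.eq_of_mem (frontier_obstacle_subset hO k hk) (h.mem (p + 1))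
        obtain ⟨N', hN', hrefl, -⟩ := h.exists_outerNormal hO hs p
        obtain ⟨N₀, -, huniq, -⟩ := exists_outerNormal_obstacle hO hk
        rw [huniq N hN, ← huniq N' hN', e2]
        exact hrefl

theorem hasAdmissibleType (hO : IsObstacle O) (hs : IsSmall O) (h : IsItinerary O u C q) :
    (h.trajectory hO hs).HasAdmissibleType := by
  refine ⟨0, _, h.admissible hO, _, h.strictMono_time hs, fun n => ?_, fun a j haj => ?_⟩
  · obtain ⟨N, hN, -, hpos⟩ := h.exists_outerNormal hO hs (n - 1)
    rw [sub_add_cancel] at hN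
    rw [sub_add_cancel, show n - 1 + 2 = n + 1 by ring] at hpos
    have hi := h.index_eq hs (n := n) ⟨le_rfl, h.strictMono_time hs (by omega : n < n + 1)⟩
    simp only [zero_add, Trajectory.ReflectsAt, trajectory, h.pos_time hs, hi]
    exact ⟨h.mem_frontier hO hs n, N, hN, hpos⟩
  · obtain ⟨n, hn, -⟩ := h.eq_time_of_mem_obstacle hO hs (frontier_obstacle_subset hO j haj.1)
    exact ⟨n, hn⟩

/-! ### Bounded deviation at all times and the rotation vector -/

theorem norm_step_le (hs : IsSmall O) (h : IsItinerary O u C q) {R : ℝ}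
    (hR : ∀ d, IsStep O d → ‖intVec d‖ ≤ R) (n : ℤ) :
    ‖(q (n + 1)).2.1 - (q n).2.1‖ ≤ R + 1 := by
  have h1 := hs.dist_obstacle (h.mem n) (h.mem (n + 1))
  have h2 := hR _ (h.at_index n).step
  have h3 := norm_sub_norm_le ((q (n + 1)).2.1 - (q n).2.1) (intVec ((q (n + 1)).1 - (q n).1))
  linarith

theorem exists_norm_pos_sub_le (hO : IsObstacle O) (hs : IsSmall O) (h : IsItinerary O u C q) :
    ∃ B, ∀ τ, ‖(h.trajectory hO hs).pos τ - τ • u‖ ≤ B := by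
  obtain ⟨R, hR⟩ := exists_bound_isStep hO
  refine ⟨C + ‖(q 0).2.1‖ + (R + 1) * (1 + ‖u‖), fun τ => ?_⟩
  obtain ⟨n, hn⟩ := h.exists_index hs τ
  have e : (h.trajectory hO hs).pos τ - τ • u
      = ((q n).2.1 - (q 0).2.1 - ((q n).2.2 - (q 0).2.2) • u) + (q 0).2.1
        + (τ - (q n).2.2) • (direction (q n).2.1 (q (n + 1)).2.1 - u) := by
    change h.pos hs τ - τ • u = _
    rw [h.pos_eq hs ⟨hn.1, hn.2.le⟩, h.time_zero]
    module
  have b1 : ‖(τ - (q n).2.2) • (direction (q n).2.1 (q (n + 1)).2.1 - u)‖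
      ≤ (R + 1) * (1 + ‖u‖) := by
    rw [norm_smul, Real.norm_eq_abs, abs_of_nonneg (sub_nonneg.2 hn.1)]
    have b2 := h.norm_step_le hs hR n
    have b3 := (h.at_index n).time
    refine mul_le_mul (by linarith [hn.2]) ?_ (norm_nonneg _) ((norm_nonneg _).trans b2)
    exact (norm_sub_le _ _).trans_eq (by rw [norm_direction (h.point_ne hs n)])
  rw [e]
  exact (norm_add_le _ _).trans (add_le_add ((norm_add_le _ _).trans
    (add_le_add (h.deviation 0 n) le_rfl)) b1)

end IsItinerary

theorem Trajectory.hasRotationVector_of_bounded {T : Trajectory O} {u : E m} {B : ℝ}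
    (h : ∀ τ, ‖T.pos τ - τ • u‖ ≤ B) : T.HasRotationVector u := by
  refine tendsto_iff_norm_sub_tendsto_zero.2 ?_
  refine squeeze_zero' (g := fun t : ℝ => t⁻¹ * (2 * B)) (.of_forall fun _ => norm_nonneg _) ?_ ?_
  · filter_upwards [eventually_gt_atTop 0] with t ht
    have e : t⁻¹ • (T.pos t - T.pos 0) - u
        = t⁻¹ • ((T.pos t - t • u) - (T.pos 0 - (0 : ℝ) • u)) := by
      rw [zero_smul, sub_zero, sub_right_comm, smul_sub _ (T.pos t - T.pos 0), smul_smul,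
        inv_mul_cancel₀ ht.ne', one_smul]
    rw [e, norm_smul, Real.norm_eq_abs, abs_of_pos (inv_pos.2 ht)]
    refine mul_le_mul_of_nonneg_left ?_ (by positivity)
    exact (norm_sub_le _ _).trans (by linarith [h t, h 0])
  · simpa using tendsto_inv_atTop_zero.mul_const (2 * B)

theorem Trajectory.exists_norm_pos_shift_le {T : Trajectory O} {u : E m} {B : ℝ}
    (h : ∀ τ, ‖T.pos τ - τ • u‖ ≤ B) (a : ℝ) (j : Fin m → ℤ) :
    ∃ B', ∀ τ, ‖(T.shift a j).pos τ - τ • u‖ ≤ B' := by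
  refine ⟨B + ‖a • u + intVec j‖, fun τ => ?_⟩
  have e : (T.shift a j).pos τ - τ • u
      = (T.pos (τ + a) - (τ + a) • u) + (a • u + intVec j) := by
    simp only [shift]; module
  rw [e]
  exact (norm_add_le _ _).trans (add_le_add (h _) le_rfl)

/-! ### Compactness of the space of itineraries -/

theorem norm_le_of_norm_step_le {V : Type*} [NormedAddCommGroup V] {f : ℤ → V} {R : ℝ}
    (h : ∀ n, ‖f (n + 1) - f n‖ ≤ R) (n : ℤ) : ‖f n‖ ≤ ‖f 0‖ + R * |(n : ℝ)| := by
  induction n using Int.induction_on with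
  | zero => simp
  | succ i ih =>
    have h1 := norm_sub_norm_le (f (i + 1)) (f i)
    have h2 := h i
    push_cast at ih ⊢
    rw [abs_of_nonneg (by positivity)] at ih ⊢
    linarith
  | pred i ih =>
    have h1 := norm_sub_norm_le (f (-i - 1)) (f (-i))
    have h2 := h (-i - 1)
    rw [sub_add_cancel, norm_sub_rev] at h2
    push_cast at ih ⊢
    rw [abs_neg, abs_of_nonneg (by positivity)] at ih
    rw [show (-(i : ℝ) - 1) = -(i + 1) by ring, abs_neg, abs_of_nonneg (by positivity)]
    linarith

/-- The possible `n`-th terms of itineraries. -/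
def itineraryBox (m : ℕ) (R ρ : ℝ) (n : ℤ) : Set ((Fin m → ℤ) × E m × ℝ) :=
  {k | ‖intVec k‖ ≤ R * |(n : ℝ)|} ×ˢ Metric.closedBall 0 (ρ + R * |(n : ℝ)|) ×ˢ
    Metric.closedBall 0 ((R + 1) * |(n : ℝ)|)

theorem isCompact_itineraryBox (R ρ : ℝ) (n : ℤ) : IsCompact (itineraryBox m R ρ n) :=
  (finite_norm_intVec_le _).isCompact.prod
    ((isCompact_closedBall _ _).prod (isCompact_closedBall _ _))

/-- Anchoring at index 0 with bounded steps confines every term. Minimality and admissibility are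
not required, so sequences that are itineraries only on a finite window also qualify. -/
theorem mem_itineraryBox (hs : IsSmall O) {R ρ : ℝ} (hρ : ∀ y ∈ O, ‖y‖ ≤ ρ)
    {q : ℤ → (Fin m → ℤ) × E m × ℝ} (h0 : (q 0).1 = 0) (ht0 : (q 0).2.2 = 0)
    (hstep : ∀ n, ‖intVec ((q (n + 1)).1 - (q n).1)‖ ≤ R)
    (hmem : ∀ n, (q n).2.1 - intVec (q n).1 ∈ O)
    (htime : ∀ n, (q (n + 1)).2.2 = (q n).2.2 + ‖(q (n + 1)).2.1 - (q n).2.1‖) (n : ℤ) :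
    q n ∈ itineraryBox m R ρ n := by
  have h1 := norm_le_of_norm_step_le (f := fun n => intVec (q n).1)
    (fun n => by rw [← intVec_sub]; exact hstep n) n
  have h2 := norm_le_of_norm_step_le (f := fun n => (q n).2.2) (R := R + 1) (fun n => by
    have h1 := hs.dist_obstacle (mem_obstacle.2 (hmem n)) (mem_obstacle.2 (hmem (n + 1)))
    have h2 := hstep n
    have h3 := norm_sub_norm_le ((q (n + 1)).2.1 - (q n).2.1) (intVec ((q (n + 1)).1 - (q n).1))
    rw [htime, add_sub_cancel_left, norm_norm]
    linarith) n
  simp only [h0, ht0, intVec_zero, norm_zero, zero_add] at h1 h2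
  refine ⟨h1, ?_, ?_⟩
  · rw [mem_closedBall_zero_iff]
    have h3 := norm_sub_norm_le (q n).2.1 (intVec (q n).1)
    linarith [hρ _ (hmem n)]
  · rwa [mem_closedBall_zero_iff]

theorem continuous_intVec : Continuous (intVec : (Fin m → ℤ) → E m) := continuous_of_discreteTopology

/-- The obstacle coordinate is discrete, and competitors range over the fixed set `O` rather than
over a moving obstacle, so minimality is an intersection of closed conditions. -/
theorem isClosed_setOf_isItineraryAt (hO : IsObstacle O) (n : ℤ) :
    IsClosed {q | IsItineraryAt O q n} := by
  have hi := continuous_intVec (m := m)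
  have e : {q | IsItineraryAt O q n} =
      (fun q : ℤ → (Fin m → ℤ) × E m × ℝ => (q (n + 1)).1 - (q n).1) ⁻¹' {d | IsStep O d} ∩
      ((fun q : ℤ → (Fin m → ℤ) × E m × ℝ => ((q (n + 1)).1 - (q n).1,
        (q (n + 2)).1 - (q (n + 1)).1)) ⁻¹' {d | Follows O d.1 d.2} ∩
      ((fun q : ℤ → (Fin m → ℤ) × E m × ℝ => (q n).2.1 - intVec (q n).1) ⁻¹' O ∩
      ({q | (q (n + 1)).2.2 = (q n).2.2 + ‖(q (n + 1)).2.1 - (q n).2.1‖} ∩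
      ⋂ y ∈ O, {q | ‖(q (n + 1)).2.1 - (q n).2.1‖ + ‖(q (n + 2)).2.1 - (q (n + 1)).2.1‖ ≤
        ‖y + intVec (q (n + 1)).1 - (q n).2.1‖
          + ‖(q (n + 2)).2.1 - (y + intVec (q (n + 1)).1)‖}))) := by
    ext q
    simp only [Set.mem_ofPred_eq, Set.mem_inter_iff, Set.mem_preimage, Set.mem_iInter]
    exact ⟨fun h => ⟨h.1, h.2, h.3, h.4, h.5⟩, fun h => ⟨h.1, h.2.1, h.2.2.1, h.2.2.2.1, h.2.2.2.2⟩⟩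
  rw [e]
  refine ((isClosed_discrete _).preimage (by fun_prop)).inter
    (((isClosed_discrete _).preimage (by fun_prop)).inter
    ((hO.isClosed.preimage (by fun_prop)).inter ((isClosed_eq (by fun_prop) (by fun_prop)).inter
    (isClosed_biInter fun y _ => isClosed_le (by fun_prop) (by fun_prop)))))

theorem isClosed_setOf_deviation_le (u : E m) (C : ℝ) (a b : ℤ) :
    IsClosed {q : ℤ → (Fin m → ℤ) × E m × ℝ |
      ‖(q b).2.1 - (q a).2.1 - ((q b).2.2 - (q a).2.2) • u‖ ≤ C} :=
  isClosed_le (by fun_prop) continuous_const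

theorem isCompact_setOf_isItinerary (hO : IsObstacle O) (hs : IsSmall O) (u : E m) (C : ℝ) :
    IsCompact {q | IsItinerary O u C q} := by
  obtain ⟨R, hR⟩ := exists_bound_isStep hO
  obtain ⟨ρ, hρ⟩ := hO.isCompact.isBounded.exists_norm_le
  refine (isCompact_univ_pi fun n => isCompact_itineraryBox R ρ n).of_isClosed_subset ?_
    fun q hq n _ => mem_itineraryBox hs hρ hq.obstacle_zero hq.time_zero
      (fun n => hR _ (hq.at_index n).step) (fun n => (hq.at_index n).mem)
      (fun n => (hq.at_index n).time) n
  have e : {q | IsItinerary O u C q} =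
      (fun q : ℤ → (Fin m → ℤ) × E m × ℝ => (q 0).1) ⁻¹' {0} ∩
      ({q | (q 0).2.2 = 0} ∩ ((⋂ n, {q | IsItineraryAt O q n}) ∩
      ⋂ a, ⋂ b, {q | ‖(q b).2.1 - (q a).2.1 - ((q b).2.2 - (q a).2.2) • u‖ ≤ C})) := by
    ext q
    simp only [Set.mem_ofPred_eq, Set.mem_inter_iff, Set.mem_preimage, Set.mem_iInter,
      Set.mem_singleton_iff]
    exact ⟨fun h => ⟨h.1, h.2, h.3, h.4⟩, fun h => ⟨h.1, h.2.1, h.2.2.1, h.2.2.2⟩⟩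
  rw [e]
  exact ((isClosed_discrete _).preimage (by fun_prop)).inter
    ((isClosed_eq (by fun_prop) continuous_const).inter
    ((isClosed_iInter fun n => isClosed_setOf_isItineraryAt hO n).inter
    (isClosed_iInter fun a => isClosed_iInter fun b => isClosed_setOf_deviation_le u C a b)))

/-! ### Existence of itineraries -/

/-- A global minimizer exists by Tychonoff; replacing one inner vertex alters only the two edges at
it. -/
theorem exists_minimal_path (hO : IsObstacle O) (k : ℤ → Fin m → ℤ) (a b : ℤ) :
    ∃ x : ℤ → E m, (∀ n, x n ∈ obstacle O (k n)) ∧ ∀ n, a ≤ n → n + 1 < b →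
      ∀ y ∈ obstacle O (k (n + 1)), ‖x (n + 1) - x n‖ + ‖x (n + 2) - x (n + 1)‖ ≤
        ‖y - x n‖ + ‖x (n + 2) - y‖ := by
  obtain ⟨o, ho⟩ := hO.nonempty
  obtain ⟨x, hx, hmin⟩ := (isCompact_univ_pi fun n => isCompact_obstacle hO (k n)).exists_isMinOn
    ⟨fun n => o + intVec (k n), fun n _ => add_mem_obstacle ho⟩
    (f := fun x : ℤ → E m => ∑ i ∈ Finset.Ico a b, ‖x (i + 1) - x i‖) (by fun_prop)
  refine ⟨x, fun n => hx n (Set.mem_univ n), fun n ha hb y hy => ?_⟩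
  have h1 : ∑ i ∈ Finset.Ico a b, ‖x (i + 1) - x i‖ ≤ ∑ i ∈ Finset.Ico a b,
      ‖Function.update x (n + 1) y (i + 1) - Function.update x (n + 1) y i‖ := by
    refine hmin fun i _ => ?_
    rcases eq_or_ne i (n + 1) with rfl | hne
    · rwa [Function.update_self]
    · rw [Function.update_of_ne hne]; exact hx i (Set.mem_univ i)
  have split : ∀ f : ℤ → ℝ, ∑ i ∈ Finset.Ico a b, f i
      = f n + (f (n + 1) + ∑ i ∈ ((Finset.Ico a b).erase n).erase (n + 1), f i) := fun f => by
    rw [Finset.add_sum_erase _ f (by simp only [Finset.mem_erase, Finset.mem_Ico]; omega),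
      Finset.add_sum_erase _ f (by simp only [Finset.mem_Ico]; omega)]
  rw [split, split fun i => ‖Function.update x (n + 1) y (i + 1) - Function.update x (n + 1) y i‖]
    at h1
  have h2 : ∑ i ∈ ((Finset.Ico a b).erase n).erase (n + 1),
      ‖Function.update x (n + 1) y (i + 1) - Function.update x (n + 1) y i‖
      = ∑ i ∈ ((Finset.Ico a b).erase n).erase (n + 1), ‖x (i + 1) - x i‖ := by
    refine Finset.sum_congr rfl fun i hi => ?_
    simp only [Finset.mem_erase] at hi
    rw [Function.update_of_ne hi.1, Function.update_of_ne (by omega)]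
  rw [h2, show n + 1 + 1 = n + 2 by ring, Function.update_self,
    Function.update_of_ne (by omega : n ≠ n + 1),
    Function.update_of_ne (by omega : n + 2 ≠ n + 1)] at h1
  linarith

theorem exists_sum_int (l : ℤ → ℝ) : ∃ t : ℤ → ℝ, t 0 = 0 ∧ ∀ n, t (n + 1) = t n + l n := by
  refine ⟨fun n => ∑ i ∈ Finset.range n.toNat, l i
    - ∑ i ∈ Finset.range (-n).toNat, l (-(i : ℤ) - 1), by simp, fun n => ?_⟩
  rcases le_or_gt 0 n with h | h
  · obtain ⟨i, rfl⟩ := Int.eq_ofNat_of_zero_le h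
    beta_reduce
    rw [show ((i : ℤ) + 1).toNat = i + 1 by omega, show (-((i : ℤ) + 1)).toNat = 0 by omega,
      show (-(i : ℤ)).toNat = 0 by omega, Int.toNat_natCast, Finset.sum_range_succ]
    ring
  · obtain ⟨i, rfl⟩ : ∃ i : ℕ, n = -(i : ℤ) - 1 := ⟨(-n - 1).toNat, by omega⟩
    beta_reduce
    rw [show (-(i : ℤ) - 1 + 1).toNat = 0 by omega, show (-(i : ℤ) - 1).toNat = 0 by omega,
      show (-(-(i : ℤ) - 1 + 1)).toNat = i by omega, show (-(-(i : ℤ) - 1)).toNat = i + 1 by omega,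
      Finset.sum_range_succ]
    ring

theorem vertex_succ_sub {P : List (Fin m → ℤ)} {i : ℕ} (h : i < P.length) :
    vertex P (i + 1) - vertex P i = P[i] := by
  rw [vertex, vertex, List.sum_take_succ _ _ h, add_sub_cancel_left]

/-- A broken line that visits obstacles in the order prescribed by a word, and that is locally
shortest, has a deviation close to the deviation of the word. -/
theorem norm_deviation_sub_wordErr_le (hO : IsObstacle O) (hs : IsSmall O) (u : E m)
    {P : List (Fin m → ℤ)} (hP : ∀ d ∈ P, IsStep O d) {x : ℕ → E m} (hx : IsPath O P x)
    (hmin : ∀ i, i + 1 < P.length → ∀ y ∈ obstacle O (vertex P (i + 1)),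
      ‖x (i + 1) - x i‖ + ‖x (i + 2) - x (i + 1)‖ ≤ ‖y - x i‖ + ‖x (i + 2) - y‖) :
    ‖x P.length - x 0 - pathLen x P.length • u - wordErr O u P‖ ≤ 1 + 2 * ‖u‖ := by
  have hne : ∀ i < P.length, x (i + 1) ≠ x i := fun i hi e => by
    have h1 := hP _ (List.getElem_mem hi)
    rw [← vertex_succ_sub hi] at h1
    refine sub_ne_zero.1 h1.1 (hs.eq_of_mem (hx _ hi) ?_)
    rw [e]
    exact hx i hi.le
  have hlow : pathLen x P.length - 2 ≤ wordLen O P := le_wordLen hO.nonempty fun y hy => by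
    have := sum_le_pathLen_of_critical hs (s := P.length) (k := vertex P) (x := x)
      (v := fun i => direction (x i) (x (i + 1))) (l := fun i => ‖x (i + 1) - x i‖) hx
      (fun i hi => norm_direction (hne i hi))
      (fun i hi => by rw [norm_smul_direction (hne i hi)]; abel)
      (fun i hi z hz => inner_direction_sub_nonpos (convex_obstacle hO _) (hx (i + 1) hi.le)
        (hne i (by omega)) (hne (i + 1) hi) (hmin i hi) hz) hy
    rw [← pathLen] at this
    linarith
  have hup := hx.wordLen_le
  have hd := hs.dist_obstacle (hx 0 (Nat.zero_le _)) (hx P.length le_rfl)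
  rw [vertex_zero, sub_zero, vertex_length] at hd
  have e : x P.length - x 0 - pathLen x P.length • u - wordErr O u P
      = (x P.length - x 0 - intVec P.sum) - (pathLen x P.length - wordLen O P) • u := by
    rw [wordErr]; module
  rw [e]
  refine (norm_sub_le _ _).trans (add_le_add (by linarith) ?_)
  rw [norm_smul, Real.norm_eq_abs, abs_of_nonneg (by linarith)]
  exact mul_le_mul_of_nonneg_right (by linarith) (norm_nonneg u)

/-- The word is recentred near its middle and realized by a shortest path. Deviations are measured
from the left end of the window, and a difference of two of them gives the factor 2. -/
theorem exists_finite_itinerary (hO : IsObstacle O) (hs : IsSmall O) (u : E m) {R ρ C : ℝ}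
    (hR0 : 0 ≤ R) (hR : ∀ d, IsStep O d → ‖intVec d‖ ≤ R) (hρ : ∀ y ∈ O, ‖y‖ ≤ ρ) (N : ℕ)
    {P : List (Fin m → ℤ)} (hlen : 2 * N + 4 ≤ P.length) (hst : ∀ d ∈ P, IsStep O d)
    (hch : P.IsChain (Follows O)) (hC : ∀ i, ‖wordErr O u (P.take i)‖ ≤ C) :
    ∃ q : ℤ → (Fin m → ℤ) × E m × ℝ, (q 0).1 = 0 ∧ (q 0).2.2 = 0 ∧
      (∀ n, q n ∈ itineraryBox m R ρ n) ∧ (∀ n : ℤ, |n| ≤ N → IsItineraryAt O q n) ∧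
      ∀ a b : ℤ, |a| ≤ N → |b| ≤ N →
        ‖(q b).2.1 - (q a).2.1 - ((q b).2.2 - (q a).2.2) • u‖ ≤ 2 * (C + 1 + 2 * ‖u‖) := by
  set c : ℕ := N + 1 with hc
  -- Beyond either end of the word the sequence is constant (`toNat` and `take` saturate), so the
  -- bound on steps holds for all indices.
  set k : ℤ → Fin m → ℤ := fun n => vertex P (n + c).toNat - vertex P c with hk
  obtain ⟨x, hx, hmin⟩ := exists_minimal_path hO k (-c) (N + 2)
  obtain ⟨t, ht0, ht⟩ := exists_sum_int fun n => ‖x (n + 1) - x n‖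
  have hki : ∀ i : ℕ, k (i - c) = vertex P i - vertex P c := fun i => by simp [hk]
  have e1 : ∀ i : ℕ, (i : ℤ) - c + 1 = ((i + 1 : ℕ) : ℤ) - c := fun i => by push_cast; ring
  have e2 : ∀ i : ℕ, (i : ℤ) - c + 2 = ((i + 2 : ℕ) : ℤ) - c := fun i => by push_cast; ring
  have hks : ∀ (i : ℕ) (hi : i < P.length), k (((i + 1 : ℕ) : ℤ) - c) - k (i - c) = P[i] :=
    fun i hi => by rw [hki, hki, sub_sub_sub_cancel_right, vertex_succ_sub hi]
  have hstep : ∀ n, ‖intVec (k (n + 1) - k n)‖ ≤ R := fun n => by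
    rcases lt_or_ge n (-c) with h | h
    · simp only [hk]
      rw [show (n + 1 + (c : ℤ)).toNat = 0 by omega, show (n + (c : ℤ)).toNat = 0 by omega, sub_self,
        intVec_zero, norm_zero]
      exact hR0
    · obtain ⟨i, rfl⟩ : ∃ i : ℕ, n = i - c := ⟨(n + c).toNat, by omega⟩
      rw [e1]
      rcases lt_or_ge i P.length with hi | hi
      · rw [hks i hi]; exact hR _ (hst _ (List.getElem_mem hi))
      · rw [hki, hki, sub_sub_sub_cancel_right, vertex, List.take_of_length_le (by omega), vertex,
          List.take_of_length_le hi, sub_self, intVec_zero, norm_zero]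
        exact hR0
  have hdev : ∀ b : ℤ, |b| ≤ N →
      ‖x b - x (-c) - (t b - t (-c)) • u‖ ≤ C + 1 + 2 * ‖u‖ := fun b hb => by
    rw [abs_le] at hb
    obtain ⟨i, rfl⟩ : ∃ i : ℕ, b = i - c := ⟨(b + c).toNat, by omega⟩
    have hil : (P.take i).length = i := by rw [List.length_take]; omega
    have hv : ∀ j ≤ i, vertex (P.take i) j = vertex P c + k (j - c) := fun j hj => by
      rw [hki, add_sub_cancel, vertex, vertex, List.take_take, min_eq_left hj]
    -- The initial part of the path need not be shortest for the prefix; being locally shortest is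
    -- enough.
    have h1 := norm_deviation_sub_wordErr_le hO hs u (P := P.take i)
      (x := fun j => x (j - c) + intVec (vertex P c))
      (fun d hd => hst d (List.mem_of_mem_take hd))
      (fun j hj => by
        rw [hil] at hj
        rw [hv j hj, obstacle_add]
        exact hx _)
      (fun j hj y hy => by
        rw [hil] at hj
        rw [hv (j + 1) hj.le] at hy
        have hy' : y - intVec (vertex P c) ∈ obstacle O (k (((j + 1 : ℕ) : ℤ) - c)) := by
          rw [← obstacle_add (j := vertex P c), sub_add_cancel]; exact hy
        have := hmin (j - c) (by omega) (by omega) (y - intVec (vertex P c)) (by rwa [e1])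
        rw [e1, e2] at this
        beta_reduce
        rw [add_sub_add_right_eq_sub, add_sub_add_right_eq_sub]
        refine this.trans (le_of_eq ?_)
        congr 2 <;> abel)
    have hpl : ∀ j : ℕ, pathLen (fun j : ℕ => x (j - c) + intVec (vertex P c)) j
        = t (j - c) - t (-c) := fun j => by
      induction j with
      | zero => simp [pathLen]
      | succ j ih =>
        rw [pathLen_succ, ih, add_sub_add_right_eq_sub, ← e1, ht]
        ring
    rw [hil, hpl, add_sub_add_right_eq_sub, Nat.cast_zero, zero_sub] at h1
    have h2 := norm_sub_norm_le (x (i - c) - x (-c) - (t (i - c) - t (-c)) • u)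
      (wordErr O u (P.take i))
    linarith [hC i]
  refine ⟨fun n => (k n, x n, t n), by simp [hk], ht0,
    mem_itineraryBox hs hρ (by simp [hk]) ht0 hstep hx ht, fun n hn => ?_, fun a b ha hb => ?_⟩
  · rw [abs_le] at hn
    obtain ⟨i, rfl⟩ : ∃ i : ℕ, n = i - c := ⟨(n + c).toNat, by omega⟩
    have hi1 : i + 1 < P.length := by omega
    refine ⟨?_, ?_, hx _, ht _, fun y hy => ?_⟩
    · change IsStep O (k (i - c + 1) - k (i - c))
      rw [e1, hks i (by omega)]
      exact hst _ (List.getElem_mem _)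
    · change Follows O (k (i - c + 1) - k (i - c)) (k (i - c + 2) - k (i - c + 1))
      rw [e2, e1, hks i (by omega), hks (i + 1) hi1]
      exact List.isChain_iff_getElem.1 hch i hi1
    · exact hmin _ (by omega) (by omega) _ (add_mem_obstacle hy)
  · have e : x b - x a - (t b - t a) • u = (x b - x (-c) - (t b - t (-c)) • u)
        - (x a - x (-c) - (t a - t (-c)) • u) := by module
    change ‖x b - x a - (t b - t a) • u‖ ≤ _
    rw [e]
    exact (norm_sub_le _ _).trans (by linarith [hdev a ha, hdev b hb])

/-- The sets `X N` of sequences in the boxes satisfying the conditions on indices up to `N` are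
compact, nested and nonempty; a common point is an itinerary. -/
theorem exists_isItinerary (hm : 2 ≤ m) (hO : IsObstacle O) (hs : IsSmall O) {u : E m}
    (hu : u ∈ interior (admissibleRotationSet O)) : ∃ C q, IsItinerary O u C q := by
  obtain ⟨R, hR⟩ := exists_bound_isStep hO
  have hR0 : 0 ≤ R := (norm_nonneg _).trans (hR _ (isStep_single hO hs ⟨0, by omega⟩ (Or.inl rfl)))
  obtain ⟨ρ, hρ⟩ := hO.isCompact.isBounded.exists_norm_le
  obtain ⟨C, hC⟩ := exists_long_word hm hO hs hu
  let X : ℕ → Set (ℤ → (Fin m → ℤ) × E m × ℝ) := fun N =>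
    Set.univ.pi (itineraryBox m R ρ) ∩ ((fun q => (q 0).1) ⁻¹' {0} ∩ ({q | (q 0).2.2 = 0} ∩
      ((⋂ n : ℤ, ⋂ _ : |n| ≤ (N : ℤ), {q | IsItineraryAt O q n}) ∩
      ⋂ a : ℤ, ⋂ b : ℤ, ⋂ _ : |a| ≤ (N : ℤ), ⋂ _ : |b| ≤ (N : ℤ),
        {q | ‖(q b).2.1 - (q a).2.1 - ((q b).2.2 - (q a).2.2) • u‖ ≤ 2 * (C + 1 + 2 * ‖u‖)})))
  have hcpt : IsCompact (Set.univ.pi (itineraryBox m R ρ)) :=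
    isCompact_univ_pi fun n => isCompact_itineraryBox R ρ n
  have hclosed : ∀ N, IsClosed (X N) := fun N => hcpt.isClosed.inter
    (((isClosed_discrete _).preimage (by fun_prop)).inter
    ((isClosed_eq (by fun_prop) continuous_const).inter
    ((isClosed_iInter fun n => isClosed_iInter fun _ => isClosed_setOf_isItineraryAt hO n).inter
    (isClosed_iInter fun a => isClosed_iInter fun b => isClosed_iInter fun _ =>
      isClosed_iInter fun _ => isClosed_setOf_deviation_le u _ a b))))
  have hmono : ∀ N, X (N + 1) ⊆ X N := fun N q hq => by
    simp only [X, Set.mem_inter_iff, Set.mem_iInter] at hq ⊢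
    obtain ⟨h1, h2, h3, h4, h5⟩ := hq
    exact ⟨h1, h2, h3, fun n hn => h4 n (by push_cast; omega),
      fun a b ha hb => h5 a b (by push_cast; omega) (by push_cast; omega)⟩
  have hne : ∀ N, (X N).Nonempty := fun N => by
    obtain ⟨P, h1, h2, h3, h4⟩ := hC (2 * N + 4)
    obtain ⟨q, g1, g2, g3, g4, g5⟩ := exists_finite_itinerary hO hs u hR0 hR hρ N h1 h2 h3 h4
    refine ⟨q, ?_⟩
    simp only [X, Set.mem_inter_iff, Set.mem_iInter]
    exact ⟨fun n _ => g3 n, g1, g2, g4, g5⟩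
  obtain ⟨q, hq⟩ := IsCompact.nonempty_iInter_of_sequence_nonempty_isCompact_isClosed X hmono hne
    (hcpt.of_isClosed_subset (hclosed 0) Set.inter_subset_left) hclosed
  have hq' : ∀ N, q ∈ X N := fun N => Set.mem_iInter.1 hq N
  simp only [X, Set.mem_inter_iff, Set.mem_iInter] at hq'
  refine ⟨2 * (C + 1 + 2 * ‖u‖), q, (hq' 0).2.1, (hq' 0).2.2.1,
    fun n => (hq' n.natAbs).2.2.2.1 n (Int.abs_eq_natAbs n).le, fun a b =>
      (hq' (max a.natAbs b.natAbs)).2.2.2.2 a b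
        (by rw [Int.abs_eq_natAbs]; exact_mod_cast le_max_left _ _)
        (by rw [Int.abs_eq_natAbs]; exact_mod_cast le_max_right _ _)⟩

/-! ### The invariant set -/

namespace IsItinerary

variable {u : E m} {C : ℝ} {q : ℤ → (Fin m → ℤ) × E m × ℝ}

/-- The deviation is bounded for all pairs of indices, not only from index 0, so `C` survives a
change of origin. -/
theorem recenter (h : IsItinerary O u C q) (n : ℤ) : IsItinerary O u C fun i =>
    ((q (i + n)).1 - (q n).1, (q (i + n)).2.1 - intVec (q n).1, (q (i + n)).2.2 - (q n).2.2) where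
  obstacle_zero := by simp
  time_zero := by simp
  at_index i := by
    have e1 : i + 1 + n = i + n + 1 := by ring
    have e2 : i + 2 + n = i + n + 2 := by ring
    obtain ⟨h1, h2, h3, h4, h5⟩ := h.at_index (i + n)
    refine ⟨by simpa [e1] using h1, by simpa [e1, e2] using h2, ?_, ?_, fun y hy => ?_⟩
    · simpa [intVec_sub] using h3
    · simp only [e1, h4, sub_sub_sub_cancel_right]; ring
    · have := h5 y hy
      simp only [e1, e2, sub_sub_sub_cancel_right, intVec_sub]
      refine this.trans (le_of_eq ?_)
      congr 2 <;> abel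
  deviation a b := by simpa using h.deviation (a + n) (b + n)

theorem pos_mul_time (hs : IsSmall O) (h : IsItinerary O u C q) {s : ℝ} (h0 : s ∈ Set.Icc 0 1) :
    h.pos hs (s * (q 1).2.2) = (q 0).2.1 + s • ((q 1).2.1 - (q 0).2.1) := by
  have ht := (h.at_index 0).time
  have hne := h.point_ne hs 0
  have hnn := norm_nonneg ((q 1).2.1 - (q 0).2.1)
  rw [zero_add, h.time_zero, zero_add] at ht
  rw [zero_add] at hne
  rw [h.pos_eq hs (n := 0) ⟨by rw [h.time_zero, ht]; exact mul_nonneg h0.1 hnn, by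
    rw [zero_add, ht]; exact mul_le_of_le_one_left hnn h0.2⟩, h.time_zero, sub_zero, zero_add,
    mul_smul, ht, norm_smul_direction hne]

/-- The position on the first segment of the itinerary and the velocity there. -/
noncomputable def firstSegment (hO : IsObstacle O) (hs : IsSmall O)
    (z : {q | IsItinerary O u C q} × Set.Icc (0 : ℝ) 1) : PrePhase O :=
  ⟨(proj ((z.1.1 0).2.1 + (z.2 : ℝ) • ((z.1.1 1).2.1 - (z.1.1 0).2.1)),
    direction (z.1.1 0).2.1 (z.1.1 1).2.1), by
      have h : IsItinerary O u C z.1.1 := z.1.2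
      rw [← h.pos_mul_time hs z.2.2]
      exact proj_notMem ((h.trajectory hO hs).outside _),
    norm_direction (by simpa using IsItinerary.point_ne hs z.1.2 0)⟩

theorem continuous_firstSegment (hO : IsObstacle O) (hs : IsSmall O) :
    Continuous (firstSegment (u := u) (C := C) hO hs) := by
  have h0 : Continuous fun z : {q | IsItinerary O u C q} × Set.Icc (0 : ℝ) 1 =>
      (z.1.1 0).2.1 :=
    ((continuous_apply 0).comp (continuous_subtype_val.comp continuous_fst)).snd.fst
  have h1 : Continuous fun z : {q | IsItinerary O u C q} × Set.Icc (0 : ℝ) 1 =>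
      (z.1.1 1).2.1 :=
    ((continuous_apply 1).comp (continuous_subtype_val.comp continuous_fst)).snd.fst
  refine Continuous.subtype_mk (Continuous.prodMk (continuous_proj.comp (by fun_prop)) ?_) _
  refine ((h1.sub h0).norm.inv₀ fun z => ?_).smul (h1.sub h0)
  exact norm_ne_zero_iff.2 (sub_ne_zero.2 (by simpa using IsItinerary.point_ne hs z.1.2 0))

/-- At the end of the segment the velocity on the left is incoming and that of the trajectory
outgoing; the gluing identifies them, which permits the compact parameter interval [0,1]. -/
theorem mk_firstSegment (hO : IsObstacle O) (hs : IsSmall O)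
    (z : {q | IsItinerary O u C q} × Set.Icc (0 : ℝ) 1) :
    (Quot.mk _ (firstSegment hO hs z) : PhaseSpace O)
      = (IsItinerary.trajectory hO hs z.1.2).phase (z.2 * (z.1.1 1).2.2) := by
  obtain ⟨⟨q, h⟩, ⟨s, h0⟩⟩ := z
  replace h : IsItinerary O u C q := h
  have ht0 := h.time_zero
  have hmono := h.strictMono_time hs zero_lt_one
  simp only [ht0] at hmono
  have hp := h.pos_mul_time hs h0
  refine Glue.mk_eq ?_
  rcases h0.2.lt_or_eq with h1 | rfl
  · left
    have hi := h.index_eq hs (τ := s * (q 1).2.2) (n := 0)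
      ⟨by rw [ht0]; exact mul_nonneg h0.1 hmono.le, by rw [zero_add]; nlinarith⟩
    refine Subtype.ext (Prod.ext ?_ ?_)
    · exact congrArg proj hp.symm
    · simp only [firstSegment, trajectory, hi, zero_add]
  · right
    obtain ⟨N, hN, hrefl, -⟩ := h.exists_outerNormal hO hs 0
    have hi := h.index_eq hs (n := 1)
      ⟨le_rfl, h.strictMono_time hs (by norm_num : (1 : ℤ) < 1 + 1)⟩
    rw [zero_add, zero_add] at hrefl
    rw [zero_add] at hN
    refine ⟨(q 1).2.1 - intVec (q 1).1, N, mem_frontier_obstacle.1 (h.mem_frontier hO hs 1),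
      isOuterNormal_obstacle.1 hN, ?_, ?_, ?_⟩
    · exact proj_eq_iff.2 ⟨(q 1).1, by simp⟩
    · exact proj_eq_iff.2 ⟨(q 1).1, by
        rw [sub_add_cancel]; simpa [trajectory] using hp⟩
    · simp only [firstSegment, trajectory, one_mul, hi]
      exact hrefl

/-- Recentring at the last reflection up to time `b` moves the phase point to a first segment. -/
theorem exists_phase_eq (hO : IsObstacle O) (hs : IsSmall O) (h : IsItinerary O u C q) (b : ℝ) :
    ∃ z : {q | IsItinerary O u C q} × Set.Icc (0 : ℝ) 1,
      (h.trajectory hO hs).phase b = Quot.mk _ (firstSegment hO hs z) := by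
  obtain ⟨n, hn⟩ := h.exists_index hs b
  have ht := (h.at_index n).time
  have hl : 0 < (q (n + 1)).2.2 - (q n).2.2 := by linarith
  refine ⟨⟨⟨_, h.recenter n⟩, ⟨(b - (q n).2.2) / ((q (n + 1)).2.2 - (q n).2.2),
    div_nonneg (by linarith) hl.le, (div_le_one hl).2 (by linarith)⟩⟩, Glue.mk_eq (Or.inl ?_)⟩
  have hi := h.index_eq hs hn
  refine Subtype.ext (Prod.ext (proj_eq_iff.2 ⟨(q n).1, ?_⟩) ?_)
  · change h.pos hs b = _
    have e := norm_smul_direction (h.point_ne hs n)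
    rw [h.pos_eq hs ⟨hn.1, hn.2.le⟩]
    simp only [zero_add, add_comm 1 n, sub_sub_sub_cancel_right]
    rw [← e, smul_smul, ht, add_sub_cancel_left, div_mul_cancel₀ _ (by linarith)]
    abel
  · simp only [trajectory, firstSegment, hi, zero_add, add_comm 1 n, direction,
      sub_sub_sub_cancel_right]

end IsItinerary

/-- The points of the phase space on trajectories with itineraries of deviation at most `C`. -/
def itinerarySet (hO : IsObstacle O) (hs : IsSmall O) (u : E m) (C : ℝ) : Set (PhaseSpace O) :=
  {p | ∃ (q : ℤ → (Fin m → ℤ) × E m × ℝ) (h : IsItinerary O u C q) (b : ℝ),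
    p = (h.trajectory hO hs).phase b}

theorem isCompact_itinerarySet (hO : IsObstacle O) (hs : IsSmall O) (u : E m) (C : ℝ) :
    IsCompact (itinerarySet hO hs u C) := by
  have : CompactSpace {q | IsItinerary O u C q} :=
    isCompact_iff_compactSpace.1 (isCompact_setOf_isItinerary hO hs u C)
  have e : itinerarySet hO hs u C
      = Set.range fun z => (Quot.mk _ (IsItinerary.firstSegment (u := u) (C := C) hO hs z) :
        PhaseSpace O) := by
    ext p
    constructor
    · rintro ⟨q, h, b, rfl⟩
      obtain ⟨z, hz⟩ := h.exists_phase_eq hO hs b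
      exact ⟨z, hz.symm⟩
    · rintro ⟨z, rfl⟩
      exact ⟨_, z.1.2, _, IsItinerary.mk_firstSegment hO hs z⟩
  rw [e]
  exact isCompact_range (continuous_quot_mk.comp (IsItinerary.continuous_firstSegment hO hs))

end TorusBilliard

theorem mainTheorem3 {m : ℕ} (hm : 2 ≤ m) (O : Set (TorusBilliard.E m))
    (hO : TorusBilliard.IsObstacle O) (hsmall : TorusBilliard.IsSmall O)
    (u : TorusBilliard.E m) (hu : u ∈ interior (TorusBilliard.admissibleRotationSet O)) :
    (∃ Y : Set (TorusBilliard.PhaseSpace O),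
      Y.Nonempty ∧ IsCompact Y ∧ TorusBilliard.IsInvariant O Y ∧
      (∀ p ∈ Y, ∃ T : TorusBilliard.Trajectory O, T.phase 0 = p) ∧
      ∀ T : TorusBilliard.Trajectory O, T.phase 0 ∈ Y →
        T.HasAdmissibleType ∧ T.HasRotationVector u) ∧
    ∃ T : TorusBilliard.Trajectory O, T.HasAdmissibleType ∧ T.HasRotationVector u := by
  obtain ⟨C, q, hq⟩ := TorusBilliard.exists_isItinerary hm hO hsmall hu
  refine ⟨⟨TorusBilliard.itinerarySet hO hsmall u C, ⟨_, q, hq, 0, rfl⟩,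
    TorusBilliard.isCompact_itinerarySet hO hsmall u C, ?_, ?_, ?_⟩,
    hq.trajectory hO hsmall, hq.hasAdmissibleType hO hsmall, ?_⟩
  -- Any trajectory meeting the set is a shift of one built from an itinerary, so it remains in the
  -- set.
  · rintro T ⟨q, h, b, hb⟩ t
    obtain ⟨j, rfl⟩ := TorusBilliard.Trajectory.eq_shift_of_phase_eq hO hsmall hb
    exact ⟨q, h, t + b, TorusBilliard.Trajectory.phase_shift t⟩
  · rintro _ ⟨q, h, b, rfl⟩
    exact ⟨(h.trajectory hO hsmall).shift b 0, by
      rw [TorusBilliard.Trajectory.phase_shift, zero_add]⟩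
  · rintro T ⟨q, h, b, hb⟩
    obtain ⟨j, rfl⟩ := TorusBilliard.Trajectory.eq_shift_of_phase_eq hO hsmall hb
    obtain ⟨B, hB⟩ := h.exists_norm_pos_sub_le hO hsmall
    obtain ⟨B', hB'⟩ := TorusBilliard.Trajectory.exists_norm_pos_shift_le hB b j
    exact ⟨(h.hasAdmissibleType hO hsmall).shift b j,
      TorusBilliard.Trajectory.hasRotationVector_of_bounded hB'⟩
  · obtain ⟨B, hB⟩ := hq.exists_norm_pos_sub_le hO hsmall
    exact TorusBilliard.Trajectory.hasRotationVector_of_bounded hB
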